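/- Let $P\subset\mathbb R^2$ be the closed region bounded by a simple polygon, and let $\mathcal T$ be any triangulation of $P$ (triangles meeting face to face, with corners among the vertices of $P$). A human $h$ and a puppy $p$ move inside $P$, starting from arbitrary positions in $P$. The puppy is infinitely fast and greedy. As long as its Euclidean distance to $h$ is not a local minimum over $P$, the human stands still and the puppy runs: it moves straight towards $h$ whenever it can do so within $P$ (at least for a short while), and otherwise it slides along the boundary of $P$ in a direction in which its distance to $h$ decreases (an arbitrary one, if there are two). When it has reached a local minimum of the distance, it rests there; as the human moves, the puppy moves along continuously so as to stay at a local minimum, until it is forced to run again. The human walks at constant speed $c>0$ and uses the following strategy. Let $t_1,\dots,t_k$ be a path of pairwise distinct, consecutively adjacent triangles in the dual graph of $\mathcal T$ (two triangles are adjacent if they share an edge) with $h\in t_1$ and $p\in t_k$, and let $d_i$ be the midpoint of the common edge of $t_i$ and $t_{i+1}$. The human walks along the polygonal path $\pi = h\,d_1d_2\dots d_{k-1}$. As soon as the puppy enters a new triangle, the human recomputes $\pi$ in the same way from the current positions of $h$ and $p$ and follows the new path. Then, for every motion $(h(t),p(t))_{t\ge 0}$ that obeys these rules, the human and the puppy meet: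 there is a finite time $t\ge 0$ with $h(t)=p(t)$. -/

import Mathlib

open Set Filter Topology

namespace Puppy

/-- The Euclidean plane. -/
abbrev Plane : Type := EuclideanSpace ℝ (Fin 2)

/-! ### Simple polygons and their triangulations -/

/-- The closed polygonal chain `poly` is simple: it has at least three vertices, they are pairwise
distinct, and two different edges meet at most in a common endpoint. -/
structure IsSimple {n : ℕ} (poly : Polygon Plane n) : Prop where
  three_le : 3 ≤ n
  injective : Function.Injective poly.vertices
  inter_subset : ∀ i j : Fin n, i ≠ j →
    poly.edgeSet ℝ i ∩ poly.edgeSet ℝ j ⊆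
      {poly i, poly (finRotate n i)} ∩ {poly j, poly (finRotate n j)}

/-- `P` is the closed region bounded by the closed polygonal chain `poly`, that is, the chain
together with its interior: the compact set that is the closure of its interior and
has the chain as its topological boundary. -/
structure IsRegion {n : ℕ} (poly : Polygon Plane n) (P : Set Plane) : Prop where
  isCompact : IsCompact P
  closure_interior : closure (interior P) = P
  frontier_eq : frontier P = poly.boundary ℝ

/-- `K` is a triangulation of the region `P` bounded by `poly`: a decomposition of `P` into
triangles which meet face to face, all of whose corners are vertices of the polygon. -/
structure IsTriangulation {n : ℕ} (poly : Polygon Plane n) (P : Set Plane)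
    (K : Geometry.SimplicialComplex ℝ Plane) : Prop where
  space_eq : K.space = P
  vertices_subset : K.vertices ⊆ range poly.vertices

/-- The triangles of a triangulation, given by their sets of corners. -/
def Tri (K : Geometry.SimplicialComplex ℝ Plane) : Type :=
  {s : Finset Plane // s ∈ K.faces ∧ s.card = 3}

/-- The closed triangle as a set of points. -/
def Tri.carrier {K : Geometry.SimplicialComplex ℝ Plane} (s : Tri K) : Set Plane :=
  convexHull ℝ (s.1 : Set Plane)

open Classical in
/-- The dual graph: two triangles are adjacent if they are different and share an edge. -/
def dualGraph (K : Geometry.SimplicialComplex ℝ Plane) : SimpleGraph (Tri K) where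
  Adj s t := s ≠ t ∧ (s.1 ∩ t.1).card = 2
  symm := ⟨fun s t h => ⟨h.1.symm, by rw [Finset.inter_comm]; exact h.2⟩⟩
  loopless := ⟨fun _ h => h.1 rfl⟩

open Classical in
/-- The midpoint of the common edge of two adjacent triangles. -/
noncomputable def gate {K : Geometry.SimplicialComplex ℝ Plane} (s t : Tri K) : Plane :=
  (s.1 ∩ t.1).centroid ℝ id

/-- The midpoints `d₁, …, d_{k-1}` of the edges crossed by a path `t₁, …, t_k` of triangles. -/
noncomputable def waypoints {K : Geometry.SimplicialComplex ℝ Plane} {s t : Tri K}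
    (w : (dualGraph K).Walk s t) : List Plane :=
  w.darts.map fun d => gate d.fst d.snd

/-! ### The puppy -/

/-- From `x`, the point `h` can be approached on a straight line inside `P`, at least for a short
while. -/
def CanApproach (P : Set Plane) (h x : Plane) : Prop :=
  ∃ y ∈ segment ℝ x h, y ≠ x ∧ segment ℝ x y ⊆ P

/-- A greedy straight move of the puppy from `x` to `y` inside `P`, with the human at `h`: straight
towards the human where that is possible, and otherwise sliding along the boundary in a direction
in which the distance to the human decreases. -/
inductive GreedyMove (P : Set Plane) (h x y : Plane) : Prop
  | straight : y ≠ x → y ∈ segment ℝ x h → segment ℝ x y ⊆ P → GreedyMove P h x y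
  | slide : y ≠ x → segment ℝ x y ⊆ frontier P → segment ℝ x y ⊆ P →
      (∀ z ∈ segment ℝ x y, z ≠ y → ¬ CanApproach P h z) →
      StrictAntiOn (fun r : ℝ => dist (AffineMap.lineMap x y r) h) (Icc 0 1) →
      GreedyMove P h x y

/-- With the human at `h`, the puppy at `x` is at rest: its distance to the human is a local minimum
over `P`. -/
def IsStable (P : Set Plane) (h x : Plane) : Prop :=
  x ∈ P ∧ IsLocalMinOn (fun z => dist z h) P x

/-- With the human standing at `h`, the puppy may run from `x` to its resting position `y`: finitely
many (possibly no) greedy moves lead from `x` to the stable position `y`. -/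
def GreedyRun (P : Set Plane) (h x y : Plane) : Prop :=
  Relation.ReflTransGen (GreedyMove P h) x y ∧ IsStable P h y

/-- The trajectory `p`, on the time interval `[0, ∞)`, of an infinitely fast greedy puppy that is
initially at `p₀`, when the human moves along `h`. At time `0` the puppy runs to a stable position.
From then on it is in a stable position at all times, and moves continuously except at those times
`t` at which the position `q` it has arrived at is not stable; then it runs from `q` to a stable
position while the human stands at `h t`. (When `q` is stable, the run from `q` is trivial, so
`p t = q`.) -/
structure IsGreedyPuppy (P : Set Plane) (p₀ : Plane) (h p : ℝ → Plane) : Prop where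
  start : GreedyRun P (h 0) p₀ (p 0)
  right_continuous : ∀ t, 0 ≤ t → ContinuousWithinAt p (Ici t) t
  run : ∀ t, 0 < t → ∃ q, Tendsto p (𝓝[<] t) (𝓝 q) ∧ GreedyRun P (h t) q (p t)

/-! ### The human -/

/-- The point at distance `r`, measured along the polygonal path, from the beginning of the
polygonal path with first point `a` and further corners `l` (its last point, if the path is
shorter than `r`). -/
noncomputable def walkAlong : Plane → List Plane → ℝ → Plane
  | a, [], _ => a
  | a, b :: l, r =>
      open Classical in
      if r ≤ dist a b then AffineMap.lineMap a b (r / dist a b) else walkAlong b l (r - dist a b)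

/-- One stage of the human's strategy, between the times `t₀` and `t₁`. At time `t₀` the human
takes a path `t₁, …, t_k` of triangles in the dual graph from a triangle that contains the human to
a triangle that contains the puppy, and walks with speed `c` along
`π = h d₁ d₂ … d_{k-1}`; the stage lasts only as long as the puppy stays in `t_k`. -/
def IsStage (K : Geometry.SimplicialComplex ℝ Plane) (c : ℝ) (h p : ℝ → Plane) (t₀ t₁ : ℝ) : Prop :=
  ∃ (s e : Tri K) (w : (dualGraph K).Path s e),
    h t₀ ∈ s.carrier ∧
    (∀ r ∈ Ico t₀ t₁, p r ∈ e.carrier) ∧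
    ∀ r ∈ Icc t₀ t₁, h r = walkAlong (h t₀) (waypoints w.1) (c * (r - t₀))

/-- The human follows the strategy with speed `c`: the time interval `[0, ∞)` is divided into
consecutive stages, with recomputation of the path at the times `τ i`, locally finitely many. The
path has to be recomputed when the puppy leaves the triangle to which the current path leads;
recomputing it at other times as well (for instance when the puppy reaches an edge or a corner shared
with another triangle) is permitted. -/
def FollowsStrategy (K : Geometry.SimplicialComplex ℝ Plane) (c : ℝ) (h p : ℝ → Plane) : Prop :=
  ∃ τ : ℕ → ℝ, τ 0 = 0 ∧ StrictMono τ ∧ Tendsto τ atTop atTop ∧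
    ∀ i, IsStage K c h p (τ i) (τ (i + 1))

end Puppy

/-! Suppose the two never meet. The argument combines two facts.

The dual graph has no cycles (`not_reach`): a cycle through a triangle `t` and its neighbour `t'`
would give a closed chain of gate midpoints inside `interior P` that crosses the common edge of `t`
and `t'` exactly once. The two ends of that edge then have different winding numbers (`separation`),
although both lie on `frontier P`, which is connected and avoids the chain. Hence the neighbours of
`t` lead into separate parts of the region. By `fan`, where simplicity of the polygon enters, these
parts touch each other only inside `t`: the triangles at a vertex form one fan, so there are no
pinch points.

The puppy cannot cross the human's triangle `t`. Since `t` is convex, a straight move that meets `t`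
ends in `t`, a slide cannot leave `t`, and the only stable position in `t` is the human's own
(`GreedyMove.mem_carrier`, `eq_of_isStable`). So while the human stays in `t`, the puppy remains
beyond one fixed neighbour `t'` (`IsGreedyPuppy.mem_region`).

Consequently every recomputed path that starts in `t` heads for the same gate, and the arrival time
there does not change. Once the human passes on to `t'`, the set of triangles in which the puppy may
be is strictly smaller (`ncard_reach_lt`). This can happen only finitely often; `isLeg_false` is the
resulting descent. -/

namespace Puppy

variable {K : Geometry.SimplicialComplex ℝ Plane}

/-! ### Barycentric coordinates of the triangles -/

namespace Tri

/-- The corners of a triangle as an affine basis of the plane. -/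
noncomputable def basis (T : Tri K) : AffineBasis T.1 ℝ Plane where
  toFun := (↑)
  ind' := K.indep T.2.1
  tot' := by
    rw [(K.indep T.2.1).affineSpan_eq_top_iff_card_eq_finrank_add_one]
    simp [T.2.2]

theorem basis_apply (T : Tri K) (v : T.1) : T.basis v = v := rfl

theorem range_basis (T : Tri K) : range T.basis = (T.1 : Set Plane) :=
  Subtype.range_coe

open Classical in
/-- The barycentric coordinate with respect to the corner `v` of a triangle. -/
noncomputable def co (T : Tri K) (v : Plane) : Plane →ᵃ[ℝ] ℝ :=
  -- The default 0 allows coordinates to be indexed by points of the plane, so that different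
  -- triangles can be compared; `co_of_ne` holds for non-corners `v` because of it.
  if h : v ∈ T.1 then T.basis.coord ⟨v, h⟩ else 0

theorem co_of_mem (T : Tri K) {v : Plane} (h : v ∈ T.1) : T.co v = T.basis.coord ⟨v, h⟩ :=
  dif_pos h

theorem co_self (T : Tri K) {v : Plane} (h : v ∈ T.1) : T.co v v = 1 := by
  rw [T.co_of_mem h]
  exact T.basis.coord_apply_eq ⟨v, h⟩

theorem co_of_ne (T : Tri K) {v w : Plane} (h : w ∈ T.1) (hne : v ≠ w) : T.co v w = 0 := by
  by_cases hv : v ∈ T.1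
  · rw [T.co_of_mem hv]
    exact T.basis.coord_apply_ne (i := ⟨v, hv⟩) (j := ⟨w, h⟩) (by simpa using hne)
  · simp [co, hv]

theorem continuous_co (T : Tri K) (v : Plane) : Continuous (T.co v) :=
  AffineMap.continuous_of_finiteDimensional _

theorem mem_carrier_iff (T : Tri K) {x : Plane} : x ∈ T.carrier ↔ ∀ v ∈ T.1, 0 ≤ T.co v x := by
  rw [carrier, ← range_basis, T.basis.convexHull_eq_nonneg_coord]
  refine ⟨fun h v hv => ?_, fun h v => ?_⟩
  · rw [T.co_of_mem hv]; exact h _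
  · have := h v.1 v.2
    rwa [T.co_of_mem v.2] at this

theorem mem_interior_of_pos (T : Tri K) {x : Plane} (h : ∀ v ∈ T.1, 0 < T.co v x) :
    x ∈ interior T.carrier := by
  rw [carrier, ← range_basis, T.basis.interior_convexHull]
  intro v
  have := h v.1 v.2
  rwa [T.co_of_mem v.2] at this

theorem sum_co (T : Tri K) (x : Plane) : ∑ v ∈ T.1, T.co v x = 1 := by
  rw [← T.basis.sum_coord_apply_eq_one x, ← Finset.sum_coe_sort]
  exact Finset.sum_congr rfl fun v _ => by rw [T.co_of_mem v.2]

theorem sum_co_smul (T : Tri K) (x : Plane) : ∑ v ∈ T.1, T.co v x • v = x := by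
  conv_rhs => rw [← T.basis.linear_combination_coord_eq_self x]
  rw [← Finset.sum_coe_sort]
  exact Finset.sum_congr rfl fun v _ => by rw [T.co_of_mem v.2, basis_apply]

theorem affineMap_eq (T : Tri K) (f : Plane →ᵃ[ℝ] ℝ) (x : Plane) :
    f x = ∑ v ∈ T.1, T.co v x * f v := by
  have hf : ∀ y, f y = f.linear y + f 0 := fun y => by
    have := congrFun f.decomp y
    simpa using this
  have e : ∑ v ∈ T.1, T.co v x * f v = ∑ v ∈ T.1, T.co v x * f.linear v + f 0 := by
    rw [Finset.sum_congr rfl fun v _ => show T.co v x * f v =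
      T.co v x * f.linear v + T.co v x * f 0 by rw [hf v, mul_add], Finset.sum_add_distrib,
      ← Finset.sum_mul, T.sum_co, one_mul]
  rw [e, hf x]
  conv_lhs => rw [← T.sum_co_smul x, map_sum]
  simp only [map_smul, smul_eq_mul]

theorem co_eq_zero_of_mem_convexHull (T : Tri K) {A : Set Plane} (hA : A ⊆ T.1) {v x : Plane}
    (hv : v ∉ A) (hx : x ∈ convexHull ℝ A) : T.co v x = 0 := by
  have hc : Convex ℝ (T.co v ⁻¹' {0}) := (convex_singleton 0).affine_preimage _
  have : convexHull ℝ A ⊆ T.co v ⁻¹' {0} := by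
    refine convexHull_min (fun w hw => ?_) hc
    exact T.co_of_ne (hA hw) (by rintro rfl; exact hv hw)
  exact this hx

theorem convex_carrier (T : Tri K) : Convex ℝ T.carrier := convex_convexHull _ _

theorem isCompact_carrier (T : Tri K) : IsCompact T.carrier :=
  T.1.finite_toSet.isCompact_convexHull (𝕜 := ℝ)

theorem isClosed_carrier (T : Tri K) : IsClosed T.carrier := T.isCompact_carrier.isClosed

theorem subset_carrier (T : Tri K) {v : Plane} (h : v ∈ T.1) : v ∈ T.carrier :=
  subset_convexHull _ _ h

theorem ext' {S T : Tri K} (h : S.1 ⊆ T.1) : S = T :=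
  Subtype.ext (Finset.eq_of_subset_of_card_le h (by rw [S.2.2, T.2.2]))

open Classical in
theorem mem_convexHull_inter {S T : Tri K} {x : Plane} (hS : x ∈ S.carrier) (hT : x ∈ T.carrier) :
    x ∈ convexHull ℝ ((S.1 ∩ T.1 : Finset Plane) : Set Plane) := by
  rw [Finset.coe_inter]
  exact K.inter_subset_convexHull S.2.1 T.2.1 ⟨hS, hT⟩

/-- This is the working form of "face to face": a common point lies in the hull of the common
corners, so its coordinate at any other corner vanishes. -/
theorem mem_of_co_pos {S T : Tri K} {x v : Plane} (hS : x ∈ S.carrier) (hT : x ∈ T.carrier)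
    (h : 0 < T.co v x) : v ∈ S.1 := by
  classical
  by_contra hv
  have := T.co_eq_zero_of_mem_convexHull (A := ((S.1 ∩ T.1 : Finset Plane) : Set Plane))
    (by simp) (v := v) (by simp [hv]) (mem_convexHull_inter hS hT)
  exact h.ne' this

theorem mem_of_vertex_mem_carrier {S T : Tri K} {v : Plane} (hS : v ∈ S.1) (hT : v ∈ T.carrier) :
    v ∈ T.1 :=
  mem_of_co_pos hT (S.subset_carrier hS) (by rw [S.co_self hS]; norm_num)

end Tri

/-! ### Adjacent triangles and their common edge -/

open Classical in
theorem dualGraph_adj_iff {S T : Tri K} : (dualGraph K).Adj S T ↔ ∃ a b c d,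
    a ≠ b ∧ a ≠ c ∧ b ≠ c ∧ a ≠ d ∧ b ≠ d ∧ c ∉ T.1 ∧ d ∉ S.1 ∧
      S.1 = {a, b, c} ∧ T.1 = {a, b, d} ∧ S.1 ∩ T.1 = {a, b} := by
  constructor
  · rintro ⟨_, h2⟩
    obtain ⟨a, b, hab, hI⟩ := Finset.card_eq_two.1 h2
    have aux : ∀ (S T : Finset Plane), S.card = 3 → S ∩ T = {a, b} →
        ∃ c, a ≠ c ∧ b ≠ c ∧ c ∉ T ∧ S = {a, b, c} := by
      intro S T hS hI
      have h1 : (S \ T).card = 1 := by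
        have := Finset.card_sdiff_add_card_inter S T
        rw [hI, Finset.card_pair hab] at this
        omega
      obtain ⟨c, hc⟩ := Finset.card_eq_one.1 h1
      have hcm : c ∈ S \ T := by simp [hc]
      have ha : a ∈ S ∩ T := by simp [hI]
      have hb : b ∈ S ∩ T := by simp [hI]
      simp only [Finset.mem_inter, Finset.mem_sdiff] at ha hb hcm
      refine ⟨c, ?_, ?_, hcm.2, ?_⟩
      · rintro rfl; exact hcm.2 ha.2
      · rintro rfl; exact hcm.2 hb.2
      · rw [← Finset.sdiff_union_inter S T, hI, hc]
        ext x; simp; tauto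
    obtain ⟨c, h1, h2, h3, h4⟩ := aux S.1 T.1 S.2.2 hI
    obtain ⟨d, h5, h6, h7, h8⟩ := aux T.1 S.1 T.2.2 (by rw [Finset.inter_comm]; exact hI)
    exact ⟨a, b, c, d, hab, h1, h2, h5, h6, h3, h7, h4, h8, hI⟩
  · rintro ⟨a, b, c, d, hab, _, _, _, _, hc, _, hS, _, hI⟩
    refine ⟨?_, by rw [hI]; exact Finset.card_pair hab⟩
    rintro rfl
    exact hc (by rw [hS]; simp)

theorem dualGraph_adj_of_mem {S T : Tri K} (hne : S ≠ T) {a b : Plane} (hab : a ≠ b)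
    (h1 : a ∈ S.1) (h2 : a ∈ T.1) (h3 : b ∈ S.1) (h4 : b ∈ T.1) : (dualGraph K).Adj S T := by
  classical
  refine ⟨hne, ?_⟩
  have hle : ({a, b} : Finset Plane) ⊆ S.1 ∩ T.1 := by
    intro x; simp only [Finset.mem_insert, Finset.mem_singleton, Finset.mem_inter]
    rintro (rfl | rfl) <;> tauto
  have h5 := Finset.card_le_card hle
  rw [Finset.card_pair hab] at h5
  have h6 : (S.1 ∩ T.1).card < 3 := by
    by_contra! h7
    have := Finset.eq_of_subset_of_card_le (Finset.inter_subset_left (s₁ := S.1) (s₂ := T.1))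
      (by rw [S.2.2]; exact h7)
    exact hne (Tri.ext' (by rw [← this]; exact Finset.inter_subset_right))
  convert! (show (S.1 ∩ T.1).card = 2 by omega)

/-- Triangles on a common edge lie on opposite sides of it. -/
theorem Tri.co_neg_of_adj {S T : Tri K} {a b c d : Plane} (hab : a ≠ b)
    (had : a ≠ d) (hbd : b ≠ d) (hd : d ∉ S.1)
    (hS : S.1 = {a, b, c}) (hT : T.1 = {a, b, d}) : S.co c d < 0 := by
  classical
  by_contra! h0
  have ha : a ∈ S.1 := by simp [hS]
  have hb : b ∈ S.1 := by simp [hS]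
  have ha' : a ∈ T.1 := by simp [hT]
  have hb' : b ∈ T.1 := by simp [hT]
  have hd' : d ∈ T.1 := by simp [hT]
  -- A point slightly off the midpoint of `ab` towards `d` lies in `T`. Were `d` on the side of `c`,
  -- the point would also lie in `S`, and its positive coordinate at `d` would make `d` a corner of
  -- `S`.
  let m : Plane := AffineMap.lineMap a b (1 / 2 : ℝ)
  let q : ℝ → Plane := fun ε => AffineMap.lineMap m d ε
  have hq : ∀ (f : Plane →ᵃ[ℝ] ℝ) ε, f (q ε) = (1 - ε) * ((f a + f b) / 2) + ε * f d := by
    intro f ε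
    simp only [q, m, AffineMap.apply_lineMap, AffineMap.lineMap_apply_ring]
    ring
  have hqc : Continuous q := AffineMap.lineMap_continuous
  have hev : ∀ v, v = a ∨ v = b → ∀ᶠ ε in 𝓝 (0 : ℝ), 0 < S.co v (q ε) := by
    intro v hv
    refine ((S.continuous_co v).comp hqc).continuousAt.eventually (lt_mem_nhds ?_)
    simp only [Function.comp, hq]
    rcases hv with rfl | rfl
    · rw [S.co_self ha, S.co_of_ne hb hab]; norm_num
    · rw [S.co_self hb, S.co_of_ne ha hab.symm]; norm_num
  obtain ⟨δ, hδ, hball⟩ := Metric.eventually_nhds_iff.1 ((hev a (.inl rfl)).and (hev b (.inr rfl)))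
  let ε := min (δ / 2) (1 / 2)
  have hε : 0 < ε := by positivity
  have hε1 : ε < δ := (min_le_left _ _).trans_lt (by linarith)
  have hε2 : ε ≤ 1 / 2 := min_le_right _ _
  obtain ⟨hpa, hpb⟩ := hball (y := ε) (by simpa [abs_of_pos hε] using hε1)
  have hxS : q ε ∈ S.carrier := by
    rw [S.mem_carrier_iff, hS]
    intro v hv
    simp only [Finset.mem_insert, Finset.mem_singleton] at hv
    rcases hv with rfl | rfl | rfl
    · exact hpa.le
    · exact hpb.le
    · rw [hq]
      by_cases hc : v = a ∨ v = b
      · rcases hc with rfl | rfl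
        · rw [← hq]; exact hpa.le
        · rw [← hq]; exact hpb.le
      push Not at hc
      rw [S.co_of_ne ha hc.1, S.co_of_ne hb hc.2]
      simp only [add_zero, zero_div, mul_zero, zero_add]
      positivity
  have hxT : q ε ∈ T.carrier := by
    rw [T.mem_carrier_iff, hT]
    intro v hv
    rw [hq]
    have h1 : ∀ w ∈ T.1, 0 ≤ T.co v w := fun w hw => by
      by_cases h : v = w
      · subst h; rw [T.co_self hw]; norm_num
      · rw [T.co_of_ne hw h]
    have := h1 a ha'; have := h1 b hb'; have := h1 d hd'
    have : 0 ≤ 1 - ε := by linarith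
    positivity
  refine hd (Tri.mem_of_co_pos hxS hxT ?_)
  rw [hq, T.co_self hd', T.co_of_ne ha' had.symm, T.co_of_ne hb' hbd.symm]
  simpa using hε

/-- The barycentric coordinate of the opposite corner changes by a factor across an edge. -/
theorem Tri.co_eq_mul {S T : Tri K} {a b c d : Plane} (hab : a ≠ b) (hac : a ≠ c) (hbc : b ≠ c)
    (had : a ≠ d) (hbd : b ≠ d)
    (hS : S.1 = {a, b, c}) (hT : T.1 = {a, b, d}) (x : Plane) :
    S.co c x = T.co d x * S.co c d := by
  classical
  rw [T.affineMap_eq (S.co c) x, hT, Finset.sum_insert (by simp [hab, had]),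
    Finset.sum_insert (by simp [hbd]), Finset.sum_singleton,
    S.co_of_ne (w := a) (by simp [hS]) hac.symm, S.co_of_ne (w := b) (by simp [hS]) hbc.symm]
  ring

/-- An edge belongs to at most two triangles. -/
theorem Tri.eq_or_eq_of_edge {S T U : Tri K} (hST : S ≠ T) {a b : Plane} (hab : a ≠ b)
    (haS : a ∈ S.1) (hbS : b ∈ S.1) (haT : a ∈ T.1) (hbT : b ∈ T.1) (haU : a ∈ U.1)
    (hbU : b ∈ U.1) : U = S ∨ U = T := by
  classical
  by_contra! h
  have key : ∀ S : Tri K, a ∈ S.1 → b ∈ S.1 → ∃ c, a ≠ c ∧ b ≠ c ∧ S.1 = {a, b, c} := by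
    intro S ha hb
    have hsub : ({a, b} : Finset Plane) ⊆ S.1 := by
      intro x; simp only [Finset.mem_insert, Finset.mem_singleton]; rintro (rfl | rfl) <;> assumption
    have h1 : (S.1 \ {a, b}).card = 1 := by
      rw [Finset.card_sdiff_of_subset hsub, S.2.2, Finset.card_pair hab]
    obtain ⟨c, hc⟩ := Finset.card_eq_one.1 h1
    have hcm : c ∈ S.1 \ {a, b} := by simp [hc]
    simp only [Finset.mem_sdiff, Finset.mem_insert, Finset.mem_singleton, not_or] at hcm
    refine ⟨c, Ne.symm hcm.2.1, Ne.symm hcm.2.2, ?_⟩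
    rw [← Finset.sdiff_union_of_subset hsub, hc]
    ext x; simp; tauto
  obtain ⟨c, hac, hbc, hS⟩ := key S haS hbS
  obtain ⟨d, had, hbd, hT⟩ := key T haT hbT
  obtain ⟨e, hae, hbe, hU⟩ := key U haU hbU
  have hnot : ∀ {S T : Tri K} {c d}, S ≠ T → S.1 = {a, b, c} → T.1 = {a, b, d} → a ≠ d → b ≠ d →
      d ∉ S.1 := by
    intro S T c d hne hS hT had hbd hd
    rw [hS] at hd
    simp only [Finset.mem_insert, Finset.mem_singleton] at hd
    rcases hd with rfl | rfl | rfl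
    · exact had rfl
    · exact hbd rfl
    · exact hne (Subtype.ext (hS.trans hT.symm))
  -- Three third corners cannot lie pairwise on opposite sides of the line `ab`: `S.co c e` would be
  -- negative and also the product of the negative numbers `T.co d e` and `S.co c d`.
  have h1 := Tri.co_neg_of_adj hab had hbd (hnot hST hS hT had hbd) hS hT
  have h2 := Tri.co_neg_of_adj hab hae hbe (hnot h.1.symm hS hU hae hbe) hS hU
  have h3 := Tri.co_neg_of_adj hab hae hbe (hnot h.2.symm hT hU hae hbe) hT hU
  have h4 := Tri.co_eq_mul hab hac hbc had hbd hS hT e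
  nlinarith

/-- Near the interior of a common edge, the two triangles cover the plane. -/
theorem Tri.mem_interior_union {S T : Tri K} {a b c d x : Plane} (hab : a ≠ b) (hac : a ≠ c)
    (hbc : b ≠ c) (had : a ≠ d) (hbd : b ≠ d) (hd : d ∉ S.1)
    (hS : S.1 = {a, b, c}) (hT : T.1 = {a, b, d}) (hx : x ∈ S.carrier) (hxa : 0 < S.co a x)
    (hxb : 0 < S.co b x) : x ∈ interior (S.carrier ∪ T.carrier) := by
  classical
  rcases ((S.mem_carrier_iff.1 hx) c (by simp [hS])).eq_or_lt with h0 | h0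
  · have haT : a ∈ T.1 := by simp [hT]
    have hbT : b ∈ T.1 := by simp [hT]
    have hT' : ∀ v, v = a ∨ v = b → 0 < T.co v x := by
      have e : ∀ f : Plane →ᵃ[ℝ] ℝ, f x = S.co a x * f a + S.co b x * f b := by
        intro f
        rw [S.affineMap_eq f x, hS, Finset.sum_insert (by simp [hab, hac]),
          Finset.sum_insert (by simp [hbc]), Finset.sum_singleton, ← h0]
        ring
      rintro v (rfl | rfl)
      · rw [e, T.co_self haT, T.co_of_ne hbT hab]; linarith
      · rw [e, T.co_self hbT, T.co_of_ne haT hab.symm]; linarith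
    rw [mem_interior_iff_mem_nhds]
    have ev : ∀ᶠ z in 𝓝 x, 0 < S.co a z ∧ 0 < S.co b z ∧ 0 < T.co a z ∧ 0 < T.co b z := by
      refine ((S.continuous_co a).continuousAt.eventually (lt_mem_nhds hxa)).and
        (((S.continuous_co b).continuousAt.eventually (lt_mem_nhds hxb)).and
        (((T.continuous_co a).continuousAt.eventually (lt_mem_nhds (hT' a (.inl rfl)))).and
        ((T.continuous_co b).continuousAt.eventually (lt_mem_nhds (hT' b (.inr rfl))))))
    filter_upwards [ev] with z ⟨h1, h2, h3, h4⟩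
    have h5 := Tri.co_neg_of_adj hab had hbd hd hS hT
    have h6 := Tri.co_eq_mul hab hac hbc had hbd hS hT z
    -- `S.co c` and `T.co d` have opposite signs at `z`, so one of them is nonnegative and decides
    -- which triangle contains `z`.
    by_cases h7 : 0 ≤ S.co c z
    · left
      rw [S.mem_carrier_iff, hS]
      intro v hv
      simp only [Finset.mem_insert, Finset.mem_singleton] at hv
      rcases hv with rfl | rfl | rfl <;> first | assumption | exact h1.le | exact h2.le
    · right
      rw [T.mem_carrier_iff, hT]
      intro v hv
      simp only [Finset.mem_insert, Finset.mem_singleton] at hv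
      rcases hv with rfl | rfl | rfl
      · exact h3.le
      · exact h4.le
      · push Not at h7
        nlinarith
  · refine interior_mono subset_union_left (S.mem_interior_of_pos ?_)
    rw [hS]
    intro v hv
    simp only [Finset.mem_insert, Finset.mem_singleton] at hv
    rcases hv with rfl | rfl | rfl <;> assumption

open Classical in
theorem gate_eq {S T : Tri K} {a b : Plane} (h : S.1 ∩ T.1 = {a, b}) :
    gate S T = AffineMap.lineMap a b (1 / 2 : ℝ) := by
  have : gate S T = ({a, b} : Finset Plane).centroid ℝ id := congrArg (Finset.centroid ℝ · id) h
  rw [this, Finset.centroid_pair, AffineMap.lineMap_apply]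
  simp

/-! ### Winding numbers of closed polygonal chains -/

/-- The total variation of `log (z - x)` as `z` runs along the polygonal chain with first point `y`
and further corners `l`. -/
noncomputable def logSum (x : ℂ) : ℂ → List ℂ → ℂ
  | _, [] => 0
  | y, z :: l => Complex.log ((z - x) / (y - x)) + logSum x z l

/-- Two consecutive corners of the chain `y, l` always satisfy `r`. -/
def ChainRel {α : Type*} (r : α → α → Prop) : α → List α → Prop
  | _, [] => True
  | y, z :: l => r y z ∧ ChainRel r z l

theorem ChainRel.mono {α β : Type*} {r : α → α → Prop} {r' : β → β → Prop} (f : α → β)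
    (h : ∀ y z, r y z → r' (f y) (f z)) :
    ∀ {y : α} {l : List α}, ChainRel r y l → ChainRel r' (f y) (l.map f)
  | _, [], _ => trivial
  | _, _ :: _, ⟨h1, h2⟩ => ⟨h _ _ h1, ChainRel.mono f h h2⟩

/-- A quotient in `(-∞, 0]` would mean that `z` and `y` lie in opposite directions from `x`, or that
one of them is `x`. Thus the principal logarithm is continuous along edges that avoid `x`. -/
theorem div_mem_slitPlane {x y z : ℂ} (h : x ∉ segment ℝ y z) :
    (z - x) / (y - x) ∈ Complex.slitPlane := by
  have hy : y - x ≠ 0 := by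
    intro h0
    exact h (by rw [← sub_eq_zero.1 h0]; exact left_mem_segment _ _ _)
  rw [Complex.mem_slitPlane_iff_not_le_zero]
  intro hle
  apply h
  obtain ⟨r, hr, hre⟩ : ∃ r : ℝ, 0 ≤ r ∧ (z - x) / (y - x) = -r := by
    rw [Complex.le_def] at hle
    refine ⟨-((z - x) / (y - x)).re, by simpa using hle.1, ?_⟩
    apply Complex.ext
    · simp
    · simpa using hle.2
  rw [div_eq_iff hy] at hre
  refine ⟨r / (1 + r), 1 / (1 + r), by positivity, by positivity, by field_simp; ring, ?_⟩
  have hz : z = x - r * (y - x) := by linear_combination hre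
  have h1 : (1 + r : ℂ) ≠ 0 := by
    have : (1 + r : ℝ) ≠ 0 := by positivity
    exact_mod_cast this
  simp only [Complex.real_smul]
  push_cast
  rw [hz]
  field_simp
  ring

/-- The quotients telescope, so the exponential is 1 for a closed chain: `logSum` is then `2πi`
times the winding number. -/
theorem exp_logSum {x : ℂ} : ∀ {y : ℂ} {l : List ℂ},
    ChainRel (fun y z => x ∉ segment ℝ y z) y l → y ≠ x →
    Complex.exp (logSum x y l) = (l.getLastD y - x) / (y - x)
  | y, [], _, hy => by
    simp [logSum, div_self (sub_ne_zero.2 hy)]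
  | y, z :: l, ⟨h1, h2⟩, hy => by
    have hz : z ≠ x := by
      rintro rfl
      exact h1 (right_mem_segment _ _ _)
    have hy' := sub_ne_zero.2 hy
    have hz' := sub_ne_zero.2 hz
    rw [logSum, Complex.exp_add, exp_logSum h2 hz, Complex.exp_log (div_ne_zero hz' hy'),
      List.getLastD_cons]
    field_simp

theorem continuousOn_logSum {S : Set ℂ} : ∀ {y : ℂ} {l : List ℂ},
    ChainRel (fun y z => Disjoint (segment ℝ y z) S) y l →
    ContinuousOn (fun x => logSum x y l) S
  | y, [], _ => by simpa [logSum] using continuousOn_const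
  | y, z :: l, ⟨h1, h2⟩ => by
    refine ContinuousOn.add (ContinuousOn.clog (ContinuousOn.div (by fun_prop) (by fun_prop) ?_) ?_)
      (continuousOn_logSum h2)
    · intro x hx h0
      exact Set.disjoint_right.1 h1 hx (by rw [← sub_eq_zero.1 h0]; exact left_mem_segment _ _ _)
    · intro x hx
      exact div_mem_slitPlane (Set.disjoint_right.1 h1 hx)

/-- `f` takes values in the discrete set `2πiℤ`, hence is constant on a connected set. This is the
invariance of the winding number. -/
theorem eq_of_exp_eq_one {S : Set ℂ} (hS : IsPreconnected S) {f : ℂ → ℂ} (hf : ContinuousOn f S)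
    (h : ∀ x ∈ S, Complex.exp (f x) = 1) {x y : ℂ} (hx : x ∈ S) (hy : y ∈ S) : f x = f y := by
  have key : ∀ x ∈ S, ∃ n : ℤ, f x = n * (2 * Real.pi * Complex.I) := fun x hx =>
    Complex.exp_eq_one_iff.1 (h x hx)
  have hd : IsDiscrete (range ((↑) : ℤ → ℝ)) :=
    isDiscrete_iff_discreteTopology.2
      (Int.isClosedEmbedding_coe_real.isEmbedding.toHomeomorph.symm.isEmbedding.discreteTopology)
  have h2 : ContinuousOn (fun x => (f x).im / (2 * Real.pi)) S :=
    (Complex.continuous_im.comp_continuousOn hf).div_const _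
  have hpi : (2 * Real.pi) ≠ 0 := by positivity
  have him : ∀ n : ℤ, ((n : ℂ) * (2 * Real.pi * Complex.I)).im / (2 * Real.pi) = n := by
    intro n
    simp [Complex.mul_im]
  have h3 := hS.constant_of_mapsTo hd h2 (fun x hx => by
    obtain ⟨n, hn⟩ := key x hx
    exact ⟨n, by simp only [hn, him]⟩) hx hy
  obtain ⟨n, hn⟩ := key x hx
  obtain ⟨m, hm⟩ := key y hy
  simp only [hn, hm, him] at h3 ⊢
  have : n = m := by exact_mod_cast h3
  rw [this]

/-- A closed polygonal chain that crosses the segment from `0` to `1` exactly once separates its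
endpoints. -/
theorem separation {S : Set ℂ} (hS : IsPreconnected S) (h0 : (0 : ℂ) ∈ S) (h1 : (1 : ℂ) ∈ S)
    {u u' : ℂ} {l : List ℂ} (hu : 0 < u.im) (hu' : u'.im < 0) (hlast : l.getLastD u' = u)
    (hl : ChainRel (fun y z => Disjoint (segment ℝ y z) (S ∪ segment ℝ 0 1)) u' l)
    (hug : Disjoint (segment ℝ u (1 / 2)) S) (hgu : Disjoint (segment ℝ (1 / 2) u') S) : False := by
  have hseg : ∀ x ∈ segment ℝ (0 : ℂ) 1, x.im = 0 := by
    rintro x ⟨a, b, _, _, _, rfl⟩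
    simp
  have hsub : ∀ {T : Set ℂ}, T ⊆ S ∪ segment ℝ 0 1 →
      ChainRel (fun y z => Disjoint (segment ℝ y z) T) u' l := by
    intro T hT
    have := ChainRel.mono (r' := fun y z => Disjoint (segment ℝ y z) T) id
      (fun y z h => Disjoint.mono_right hT h) hl
    simpa using this
  have hpt : ∀ {x}, x ∈ S ∪ segment ℝ 0 1 → ChainRel (fun y z => x ∉ segment ℝ y z) u' l := by
    intro x hx
    have := ChainRel.mono (r' := fun y z => x ∉ segment ℝ y z) id
      (fun y z h => Set.disjoint_right.1 h hx) hl
    simpa using this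
  -- `f1` is the variation of the logarithm along the chain closed up through `1 / 2`; it is
  -- constant on `S`. In `f2` the piece from `u` to `u'` is replaced by a difference of principal
  -- branches, which amounts to passing to the right of `x`; this is constant on the segment from 0
  -- to 1.
  let f1 : ℂ → ℂ := fun x => logSum x u' l +
    (Complex.log ((1 / 2 - x) / (u - x)) + Complex.log ((u' - x) / (1 / 2 - x)))
  let f2 : ℂ → ℂ := fun x => logSum x u' l + (Complex.log (u' - x) - Complex.log (u - x))
  have hne : ∀ {y z x : ℂ} {T : Set ℂ}, Disjoint (segment ℝ y z) T → x ∈ T →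
      y - x ≠ 0 ∧ z - x ≠ 0 := by
    intro y z x T hd hx
    constructor
    · intro h
      exact Set.disjoint_right.1 hd hx (by rw [← sub_eq_zero.1 h]; exact left_mem_segment _ _ _)
    · intro h
      exact Set.disjoint_right.1 hd hx (by rw [← sub_eq_zero.1 h]; exact right_mem_segment _ _ _)
  have e1 : f1 0 = f1 1 := by
    refine eq_of_exp_eq_one hS ?_ ?_ h0 h1
    · refine (continuousOn_logSum (hsub subset_union_left)).add (ContinuousOn.add ?_ ?_)
      · refine ContinuousOn.clog (ContinuousOn.div (by fun_prop) (by fun_prop) ?_) ?_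
        · exact fun x hx => (hne hug hx).1
        · exact fun x hx => div_mem_slitPlane (Set.disjoint_right.1 hug hx)
      · refine ContinuousOn.clog (ContinuousOn.div (by fun_prop) (by fun_prop) ?_) ?_
        · exact fun x hx => (hne hgu hx).1
        · exact fun x hx => div_mem_slitPlane (Set.disjoint_right.1 hgu hx)
    · intro x hx
      obtain ⟨h2, h3⟩ := hne hug hx
      have h4 := (hne hgu hx).2
      simp only [f1]
      rw [Complex.exp_add, Complex.exp_add, exp_logSum (hpt (.inl hx)) (sub_ne_zero.1 h4), hlast,
        Complex.exp_log (div_ne_zero h3 h2), Complex.exp_log (div_ne_zero h4 h3)]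
      generalize (1 / 2 : ℂ) - x = w at *
      field_simp
  have him : ∀ {w x : ℂ}, x ∈ segment ℝ (0 : ℂ) 1 → (w - x).im = w.im := by
    intro w x hx
    simp [hseg x hx]
  have hne0 : ∀ {w : ℂ}, w.im ≠ 0 → w ≠ 0 := by
    rintro w hw rfl
    simp at hw
  have e2 : f2 0 = f2 1 := by
    refine eq_of_exp_eq_one (convex_segment (0 : ℂ) 1).isPreconnected ?_ ?_
      (left_mem_segment _ _ _) (right_mem_segment _ _ _)
    · refine (continuousOn_logSum (hsub subset_union_right)).add (ContinuousOn.sub ?_ ?_)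
      · refine ContinuousOn.clog (by fun_prop) fun x hx => ?_
        right; rw [him hx]; exact hu'.ne
      · refine ContinuousOn.clog (by fun_prop) fun x hx => ?_
        right; rw [him hx]; exact hu.ne'
    · intro x hx
      have h2 : u - x ≠ 0 := hne0 (by rw [him hx]; exact hu.ne')
      have h3 : u' - x ≠ 0 := hne0 (by rw [him hx]; exact hu'.ne)
      simp only [f2]
      rw [Complex.exp_add, Complex.exp_sub, exp_logSum (hpt (.inr hx)) (sub_ne_zero.1 h3), hlast,
        Complex.exp_log h2, Complex.exp_log h3]
      field_simp
  have hinv : ∀ {w : ℂ}, 0 < w.im → Complex.log (1 / w) = -Complex.log w := by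
    intro w hw
    rw [one_div, Complex.log_inv]
    intro h
    rw [Complex.arg_eq_pi_iff] at h
    exact hw.ne' h.2
  have hneg : ∀ {w : ℂ}, w.im < 0 → Complex.log (-w) = Complex.log w + Real.pi * Complex.I := by
    intro w hw
    apply Complex.ext
    · simp [Complex.log_re]
    · simp [Complex.log_im, Complex.arg_neg_eq_arg_add_pi_of_im_neg hw]
  have hscale : ∀ {r : ℝ} {w : ℂ}, 0 < r → w ≠ 0 →
      Complex.log (r * w) = Real.log r + Complex.log w := fun hr hw =>
    Complex.log_ofReal_mul hr hw
  have a0 : Complex.log ((1 / 2 - 0) / (u - 0)) + Complex.log ((u' - 0) / (1 / 2 - 0)) =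
      Complex.log (u' - 0) - Complex.log (u - 0) := by
    have hu0 : u ≠ 0 := hne0 hu.ne'
    have hu0' : u' ≠ 0 := hne0 hu'.ne
    rw [show (1 / 2 - 0) / (u - 0) = ((1 / 2 : ℝ) : ℂ) * (1 / u) by push_cast; field_simp; simp,
      show (u' - 0) / (1 / 2 - 0) = ((2 : ℝ) : ℂ) * u' by push_cast; field_simp; simp,
      hscale (by norm_num) (by simpa using hu0), hscale (by norm_num) hu0', hinv hu, one_div,
      Real.log_inv]
    simp
    ring
  -- The point `1 / 2` is to the right of 0, where `f1` and `f2` agree, but to the left of 1, where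
  -- they differ by a full turn.
  have a1 : Complex.log ((1 / 2 - 1) / (u - 1)) + Complex.log ((u' - 1) / (1 / 2 - 1)) =
      Complex.log (u' - 1) - Complex.log (u - 1) + 2 * Real.pi * Complex.I := by
    have hv : 0 < (u - 1).im := by simpa using hu
    have hv' : (u' - 1).im < 0 := by simpa using hu'
    generalize u - 1 = v at *
    generalize u' - 1 = v' at *
    have hv0 : v ≠ 0 := hne0 hv.ne'
    have hv0' : v' ≠ 0 := hne0 hv'.ne
    have hi : (1 / v).im < 0 := by
      rw [one_div, Complex.inv_im, neg_div]
      have : 0 < Complex.normSq v := Complex.normSq_pos.2 hv0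
      have := div_pos hv this
      linarith
    rw [show (1 / 2 - 1) / v = ((1 / 2 : ℝ) : ℂ) * (-(1 / v)) by push_cast; field_simp; norm_num,
      show v' / (1 / 2 - 1) = ((2 : ℝ) : ℂ) * (-v') by push_cast; norm_num; ring,
      hscale (by norm_num) (by simpa using hv0), hscale (by norm_num) (by simpa using hv0'),
      hneg hi, hneg hv', hinv hv, one_div, Real.log_inv]
    push_cast
    ring
  simp only [f1, f2] at e1 e2
  rw [a0, a1] at e1
  have h2 : (2 * Real.pi * Complex.I : ℂ) = 0 := by linear_combination e2 - e1
  simp [Real.pi_ne_zero] at h2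

variable {n : ℕ} {poly : Polygon Plane n} {P : Set Plane}

/-! ### The boundary of a polygon -/

theorem edgeSet_eq_segment (poly : Polygon Plane n) (i : Fin n) :
    poly.edgeSet ℝ i = segment ℝ (poly i) (poly (finRotate n i)) :=
  affineSegment_eq_segment _ _ _

theorem isPreconnected_boundary (poly : Polygon Plane n) : IsPreconnected (poly.boundary ℝ) := by
  cases n with
  | zero => simpa [Polygon.boundary] using isPreconnected_empty
  | succ m =>
    refine IsPreconnected.iUnion_of_chain (fun i => ?_) fun i => ?_
    · rw [edgeSet_eq_segment]
      exact (convex_segment _ _).isPreconnected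
    · simp only [edgeSet_eq_segment]
      induction i using Fin.lastCases with
      -- The order successor of the last index is itself; the closing coincidence of the polygon is
      -- not needed for connectedness.
      | last =>
        rw [Fin.orderSucc_last, inter_self]
        exact ⟨_, left_mem_segment _ _ _⟩
      | cast i =>
        rw [Fin.orderSucc_castSucc]
        refine ⟨poly i.succ, ?_, left_mem_segment _ _ _⟩
        have : finRotate (m + 1) i.castSucc = i.succ := by
          rw [finRotate_apply, Fin.coeSucc_eq_succ]
        rw [this]
        exact right_mem_segment _ _ _

/-- Polar coordinates with an angle in `[0, 2π)`. -/
theorem exists_polar (z : ℂ) : ∃ φ, 0 ≤ φ ∧ φ < 2 * Real.pi ∧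
    z = ‖z‖ * Complex.exp (φ * Complex.I) := by
  by_cases h : 0 ≤ z.arg
  · exact ⟨z.arg, h, by have := z.arg_le_pi; have := Real.pi_pos; linarith,
      (Complex.norm_mul_exp_arg_mul_I z).symm⟩
  · refine ⟨z.arg + 2 * Real.pi, by have := z.neg_pi_lt_arg; linarith, by linarith, ?_⟩
    push_cast
    rw [add_mul, Complex.exp_add, Complex.exp_two_pi_mul_I, mul_one]
    exact (Complex.norm_mul_exp_arg_mul_I z).symm

theorem exp_mul_I_ne_real {φ : ℝ} (h1 : -(2 * Real.pi) < φ) (h2 : φ < 2 * Real.pi) (h0 : φ ≠ 0)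
    {s : ℝ} (hs : 0 ≤ s) : Complex.exp (φ * Complex.I) ≠ s := by
  intro h
  have h3 : s = 1 := by
    have := congrArg norm h
    rw [Complex.norm_exp_ofReal_mul_I, Complex.norm_real, Real.norm_of_nonneg hs] at this
    exact this.symm
  rw [h3, Complex.ofReal_one, Complex.exp_eq_one_iff] at h
  obtain ⟨k, hk⟩ := h
  have h4 : φ = k * (2 * Real.pi) := by
    have : (φ : ℂ) * Complex.I = ((k * (2 * Real.pi) : ℝ) : ℂ) * Complex.I := by
      rw [hk]; push_cast; ring
    exact_mod_cast mul_right_cancel₀ Complex.I_ne_zero this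
  have hpi := Real.pi_pos
  have h5 : k = 0 := by
    have a1 : (-1 : ℝ) < k := by
      by_contra! h
      nlinarith
    have a2 : (k : ℝ) < 1 := by
      by_contra! h
      nlinarith
    have a1' : -1 < k := by exact_mod_cast a1
    have a2' : k < 1 := by exact_mod_cast a2
    omega
  rw [h5] at h4
  simp at h4
  exact h0 h4

/-- Two rays divide a disk around their common starting point into at most two connected sectors. -/
theorem exists_sectors {z₁ z₂ : ℂ} (h₁ : z₁ ≠ 0) (h₂ : z₂ ≠ 0) (ε : ℝ) :
    ∃ S₁ S₂ : Set ℂ, IsPreconnected S₁ ∧ IsPreconnected S₂ ∧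
      (∀ x ∈ S₁ ∪ S₂, ‖x‖ < ε ∧ ∀ s : ℝ, 0 ≤ s → x ≠ s * z₁ ∧ x ≠ s * z₂) ∧
      ∀ x : ℂ, ‖x‖ < ε → (∀ s : ℝ, 0 ≤ s → x ≠ s * z₁ ∧ x ≠ s * z₂) → x ∈ S₁ ∪ S₂ := by
  obtain ⟨θ, hθ0, hθ1, hθ⟩ := exists_polar (z₂ / z₁)
  set ρ := ‖z₂ / z₁‖
  have hρ : 0 < ρ := norm_pos_iff.2 (div_ne_zero h₂ h₁)
  -- Polar coordinates rotated so that `z₁` has angle 0; then `z₂` has angle `θ`. If `θ = 0`, the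
  -- first of the two sectors is empty.
  let Ψ : ℝ × ℝ → ℂ := fun q => z₁ / ‖z₁‖ * (q.1 * Complex.exp (q.2 * Complex.I))
  have hn : (‖z₁‖ : ℂ) ≠ 0 := by exact_mod_cast (norm_pos_iff.2 h₁).ne'
  have hΨ : Continuous Ψ := by fun_prop
  have hz₂ : z₂ = z₁ * (ρ * Complex.exp (θ * Complex.I)) := by
    rw [← hθ]; field_simp
  have hpre : ∀ a b : ℝ, IsPreconnected (Ψ '' (Ioo 0 ε ×ˢ Ioo a b)) := fun a b =>
    (((convex_Ioo 0 ε).prod (convex_Ioo a b)).isPreconnected).image _ hΨ.continuousOn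
  have hnorm : ∀ q : ℝ × ℝ, 0 ≤ q.1 → ‖Ψ q‖ = q.1 := by
    intro q hq
    simp only [Ψ, norm_mul, norm_div, Complex.norm_real, norm_norm, Complex.norm_exp_ofReal_mul_I,
      mul_one, Real.norm_of_nonneg hq]
    rw [div_self (norm_pos_iff.2 h₁).ne', one_mul]
  have key : ∀ q : ℝ × ℝ, 0 < q.1 → 0 < q.2 → q.2 < 2 * Real.pi → q.2 ≠ θ →
      ∀ s : ℝ, 0 ≤ s → Ψ q ≠ s * z₁ ∧ Ψ q ≠ s * z₂ := by
    intro q h1 h2 h3 h4 s hs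
    have hq : (q.1 : ℂ) ≠ 0 := by exact_mod_cast h1.ne'
    constructor
    · intro h
      refine exp_mul_I_ne_real (s := s * ‖z₁‖ / q.1) (by linarith) h3 h2.ne' (by positivity) ?_
      simp only [Ψ] at h
      push_cast
      field_simp at h ⊢
      linear_combination h
    · intro h
      refine exp_mul_I_ne_real (φ := q.2 - θ) (s := s * ρ * ‖z₁‖ / q.1) (by linarith)
        (by linarith) (sub_ne_zero.2 h4) (by positivity) ?_
      simp only [Ψ] at h
      rw [hz₂] at h
      push_cast
      rw [sub_mul, Complex.exp_sub]
      have := Complex.exp_ne_zero (θ * Complex.I)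
      field_simp at h ⊢
      linear_combination h
  refine ⟨Ψ '' (Ioo 0 ε ×ˢ Ioo 0 θ), Ψ '' (Ioo 0 ε ×ˢ Ioo θ (2 * Real.pi)), hpre _ _, hpre _ _,
    ?_, ?_⟩
  · rintro x (⟨q, ⟨⟨ha, hb⟩, ⟨hc, hd⟩⟩, rfl⟩ | ⟨q, ⟨⟨ha, hb⟩, ⟨hc, hd⟩⟩, rfl⟩)
    · exact ⟨by rw [hnorm q ha.le]; exact hb, key q ha hc (hd.trans hθ1) hd.ne⟩
    · exact ⟨by rw [hnorm q ha.le]; exact hb, key q ha (hθ0.trans_lt hc) hd hc.ne'⟩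
  · intro x hx hray
    obtain ⟨φ, h0, h1, h2⟩ := exists_polar (x * ‖z₁‖ / z₁)
    have hxn : ‖x * ‖z₁‖ / z₁‖ = ‖x‖ := by
      rw [norm_div, norm_mul, Complex.norm_real, norm_norm, mul_div_assoc,
        div_self (norm_pos_iff.2 h₁).ne', mul_one]
    rw [hxn] at h2
    have hxΨ : Ψ (‖x‖, φ) = x := by
      simp only [Ψ]
      rw [← h2]
      field_simp
    have hx0 : 0 < ‖x‖ := by
      rw [norm_pos_iff]
      rintro rfl
      exact (hray 0 le_rfl).1 (by simp)
    have hφ0 : φ ≠ 0 := by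
      rintro rfl
      refine (hray (‖x‖ / ‖z₁‖) (by positivity)).1 ?_
      conv_lhs => rw [← hxΨ]
      simp only [Ψ]
      push_cast
      rw [zero_mul, Complex.exp_zero]
      ring
    have hφθ : φ ≠ θ := by
      rintro rfl
      refine (hray (‖x‖ / ‖z₁‖ / ρ) (by positivity)).2 ?_
      have hρ' : (ρ : ℂ) ≠ 0 := by exact_mod_cast hρ.ne'
      rw [hz₂]
      push_cast
      conv_lhs => rw [← hxΨ]
      simp only [Ψ]
      field_simp
    rcases lt_or_gt_of_ne hφθ with h | h
    · exact .inl ⟨(‖x‖, φ), ⟨⟨hx0, hx⟩, ⟨lt_of_le_of_ne h0 hφ0.symm, h⟩⟩, hxΨ⟩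
    · exact .inr ⟨(‖x‖, φ), ⟨⟨hx0, hx⟩, ⟨h, h1⟩⟩, hxΨ⟩

/-- Near a vertex, a simple polygon divides the plane into at most two connected sectors. -/
theorem exists_sectors_of_vertex (hpoly : IsSimple poly) (i : Fin n) {ε₀ : ℝ} (hε₀ : 0 < ε₀) :
    ∃ ε, 0 < ε ∧ ε ≤ ε₀ ∧ ∃ S₁ S₂ : Set Plane, IsPreconnected S₁ ∧ IsPreconnected S₂ ∧
      S₁ ∪ S₂ = Metric.ball (poly i) ε \ poly.boundary ℝ := by
  have hrot : ∀ k : Fin n, poly (finRotate n k) ≠ poly k := by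
    intro k hk
    have h3 := hpoly.three_le
    have hfix := hpoly.injective hk
    obtain ⟨m, rfl⟩ : ∃ m, n = m + 3 := ⟨n - 3, by omega⟩
    rw [finRotate_apply, add_eq_left] at hfix
    simp at hfix
  set j := (finRotate n).symm i with hj
  have hji : finRotate n j = i := Equiv.apply_symm_apply _ _
  set v := poly i with hv
  set w₁ := poly (finRotate n i) with hw₁
  set w₂ := poly j with hw₂
  have h1 : w₁ ≠ v := hrot i
  have h2 : w₂ ≠ v := by
    have := hrot j
    rw [hji] at this
    exact this.symm
  have hothers : ∀ k, k ≠ i → k ≠ j → v ∉ poly.edgeSet ℝ k := by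
    intro k hki hkj hvk
    have hvi : v ∈ poly.edgeSet ℝ i := by
      rw [edgeSet_eq_segment]; exact left_mem_segment _ _ _
    have := (hpoly.inter_subset k i hki ⟨hvk, hvi⟩).1
    rcases this with h | h
    · exact hki (hpoly.injective h.symm)
    · have := hpoly.injective h
      exact hkj (by rw [hj, this, Equiv.symm_apply_apply])
  let C : Set Plane := ⋃ k ∈ ({k | k ≠ i ∧ k ≠ j} : Set (Fin n)), poly.edgeSet ℝ k
  have hC : IsClosed C := by
    refine (Set.toFinite _).isClosed_biUnion fun k _ => ?_
    rw [edgeSet_eq_segment, segment_eq_image_lineMap]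
    exact (isCompact_Icc.image (by fun_prop)).isClosed
  have hvC : v ∉ C := by
    simp only [C, mem_iUnion, not_exists]
    exact fun k hk => hothers k hk.1 hk.2
  obtain ⟨ε₁, hε₁, hball⟩ := Metric.isOpen_iff.1 hC.isOpen_compl v hvC
  -- The ball misses all edges not ending at `v` and is no larger than the two that do, so within it
  -- the boundary coincides with two full rays.
  let ε := min (min ε₀ ε₁) (min (dist w₁ v) (dist w₂ v))
  have hε : 0 < ε := lt_min (lt_min hε₀ hε₁) (lt_min (dist_pos.2 h1) (dist_pos.2 h2))
  have hεC : ∀ x, dist x v < ε → x ∉ C := fun x hx =>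
    hball (Metric.mem_ball.2 (hx.trans_le ((min_le_left _ _).trans (min_le_right _ _))))
  have hε1 : ε ≤ dist w₁ v := (min_le_right _ _).trans (min_le_left _ _)
  have hε2 : ε ≤ dist w₂ v := (min_le_right _ _).trans (min_le_right _ _)
  let e := Complex.orthonormalBasisOneI.repr
  let F : ℂ → Plane := fun z => e z + v
  have hF : Continuous F := by fun_prop
  have hFn : ∀ z, dist (F z) v = ‖z‖ := by
    intro z
    simp [F]
  have hz : ∀ w : Plane, e (e.symm (w - v)) = w - v := fun w => e.apply_symm_apply _
  have hray : ∀ (z : ℂ) (s : ℝ) (w : Plane), z = s * e.symm (w - v) ↔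
      F z = AffineMap.lineMap v w s := by
    intro z s w
    rw [← e.injective.eq_iff, AffineMap.lineMap_apply, vsub_eq_sub, vadd_eq_add,
      ← Complex.real_smul, map_smul, hz]
    simp [F]
  obtain ⟨S₁, S₂, hS₁, hS₂, hin, hout⟩ := exists_sectors (z₁ := e.symm (w₁ - v))
    (z₂ := e.symm (w₂ - v)) (by simpa [sub_eq_zero] using h1) (by simpa [sub_eq_zero] using h2) ε
  refine ⟨ε, hε, (min_le_left _ _).trans (min_le_left _ _), F '' S₁, F '' S₂,
    hS₁.image _ hF.continuousOn, hS₂.image _ hF.continuousOn, ?_⟩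
  have hnear : ∀ x : Plane, dist x v < ε → (x ∈ poly.boundary ℝ ↔
      ∃ s : ℝ, 0 ≤ s ∧ (x = AffineMap.lineMap v w₁ s ∨ x = AffineMap.lineMap v w₂ s)) := by
    intro x hx
    constructor
    · intro h
      obtain ⟨k, hk⟩ := mem_iUnion.1 h
      by_cases hki : k = i
      · subst hki
        obtain ⟨s, hs, rfl⟩ := hk
        exact ⟨s, hs.1, .inl rfl⟩
      by_cases hkj : k = j
      · rw [hkj, edgeSet_eq_segment, hji, segment_symm, segment_eq_image_lineMap] at hk
        obtain ⟨s, hs, rfl⟩ := hk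
        exact ⟨s, hs.1, .inr rfl⟩
      · exact (hεC x hx (mem_biUnion (show k ∈ {k | k ≠ i ∧ k ≠ j} from ⟨hki, hkj⟩) hk)).elim
    · have hs1 : ∀ (s : ℝ) (w : Plane), 0 ≤ s → ε ≤ dist w v →
          x = AffineMap.lineMap v w s → s ≤ 1 := by
        intro s w hs hw hxs
        by_contra! h
        rw [hxs, dist_lineMap_left, Real.norm_of_nonneg hs, dist_comm v w] at hx
        nlinarith [dist_nonneg (x := w) (y := v)]
      rintro ⟨s, hs, h | h⟩
      · refine mem_iUnion.2 ⟨i, ?_⟩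
        exact ⟨s, ⟨hs, hs1 s w₁ hs hε1 h⟩, h.symm⟩
      · refine mem_iUnion.2 ⟨j, ?_⟩
        rw [edgeSet_eq_segment, hji, segment_symm, segment_eq_image_lineMap]
        exact ⟨s, ⟨hs, hs1 s w₂ hs hε2 h⟩, h.symm⟩
  ext x
  obtain ⟨z, rfl⟩ : ∃ z, F z = x := ⟨e.symm (x - v), by simp [F]⟩
  have hFi : Function.Injective F := fun a b h => e.injective (add_right_cancel h)
  rw [← image_union, hFi.mem_set_image, Set.mem_sdiff, Metric.mem_ball]
  have hzz : dist (F z) v < ε → (F z ∉ poly.boundary ℝ ↔ ∀ s : ℝ, 0 ≤ s →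
      z ≠ s * e.symm (w₁ - v) ∧ z ≠ s * e.symm (w₂ - v)) := by
    intro h
    rw [hnear _ h]
    push Not
    simp only [ne_eq, hray]
  constructor
  · intro h
    obtain ⟨h3, h4⟩ := hin z h
    rw [← hFn] at h3
    exact ⟨h3, (hzz h3).2 h4⟩
  · rintro ⟨h3, h4⟩
    exact hout z (by rw [← hFn]; exact h3) ((hzz h3).1 h4)

/-! ### The triangles of a triangulation -/

theorem IsTriangulation.finite_tri (hK : IsTriangulation poly P K) : Finite (Tri K) := by
  classical
  have hfin : (range poly.vertices).Finite := finite_range _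
  let f : Tri K → (hfin.toFinset.powerset : Finset (Finset Plane)) := fun T => ⟨T.1, by
    rw [Finset.mem_powerset]
    intro v hv
    rw [hfin.mem_toFinset]
    exact hK.vertices_subset (K.down_closed T.2.1 (by simpa using hv) (by simp))⟩
  exact Finite.of_injective f fun S T h => Subtype.ext (congrArg (fun q => q.1) h)

theorem IsTriangulation.finite_faces (hK : IsTriangulation poly P K) : K.faces.Finite := by
  have hfin : (range poly.vertices).Finite := finite_range _
  refine hfin.toFinset.powerset.finite_toSet.subset fun s hs => ?_
  rw [Finset.mem_coe, Finset.mem_powerset]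
  intro v hv
  rw [hfin.mem_toFinset]
  exact hK.vertices_subset (K.down_closed hs (by simpa using hv) (by simp))

theorem Tri.mem_vertices (T : Tri K) {v : Plane} (hv : v ∈ T.1) : v ∈ K.vertices :=
  K.down_closed T.2.1 (by simpa using hv) (by simp)

theorem Tri.carrier_subset (hK : IsTriangulation poly P K) (T : Tri K) : T.carrier ⊆ P := by
  rw [← hK.space_eq]
  exact K.convexHull_subset_space T.2.1

theorem Tri.interior_nonempty (T : Tri K) : (interior T.carrier).Nonempty := by
  rw [carrier, ← range_basis]
  exact ⟨_, T.basis.centroid_mem_interior_convexHull⟩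

theorem Tri.carrier_subset_closure_interior (T : Tri K) : T.carrier ⊆ closure (interior T.carrier) := by
  rw [T.convex_carrier.closure_interior_eq_closure_of_nonempty_interior T.interior_nonempty]
  exact subset_closure

/-- A triangulated region is the union of the triangles. -/
theorem IsTriangulation.exists_tri (hP : IsRegion poly P) (hK : IsTriangulation poly P K)
    {x : Plane} (hx : x ∈ P) : ∃ T : Tri K, x ∈ T.carrier := by
  have := hK.finite_tri
  let Q : Set Plane := ⋃ T : Tri K, T.carrier
  have hQ : IsClosed Q := isClosed_iUnion_of_finite fun T => T.isClosed_carrier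
  -- The faces that are not triangles have empty interior and are convex, hence null; an open set
  -- covered by them is empty.
  let N : Set Plane := ⋃ s ∈ {s ∈ K.faces | s.card ≠ 3}, convexHull ℝ (s : Set Plane)
  have hN : MeasureTheory.volume N = 0 := by
    refine (MeasureTheory.measure_biUnion_null_iff
      ((hK.finite_faces.subset (fun s hs => hs.1)).countable)).2 fun s hs => ?_
    have hint : interior (convexHull ℝ (s : Set Plane)) = ∅ := by
      by_contra h
      have htop := interior_convexHull_nonempty_iff_affineSpan_eq_top.1 (nonempty_iff_ne_empty.2 h)
      have hcard := (K.indep hs.1).affineSpan_eq_top_iff_card_eq_finrank_add_one.1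
        (by rwa [Subtype.range_coe])
      exact hs.2 (by simpa using hcard)
    have hcl : IsClosed (convexHull ℝ (s : Set Plane)) :=
      (s.finite_toSet.isCompact_convexHull (𝕜 := ℝ)).isClosed
    have := (convex_convexHull ℝ (s : Set Plane)).addHaar_frontier MeasureTheory.volume
    rwa [hcl.frontier_eq, hint, sdiff_empty] at this
  have hsub : interior P \ Q ⊆ N := by
    rintro y ⟨hy, hyQ⟩
    have hyP := interior_subset hy
    rw [← hK.space_eq] at hyP
    obtain ⟨s, hs, hys⟩ := K.mem_space_iff.1 hyP
    refine mem_biUnion (show s ∈ {s ∈ K.faces | s.card ≠ 3} from ⟨hs, fun h3 => hyQ ?_⟩) hys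
    exact mem_iUnion.2 ⟨⟨s, hs, h3⟩, hys⟩
  have hempty : interior P \ Q = ∅ := by
    have hopen : IsOpen (interior P \ Q) := isOpen_interior.sdiff hQ
    by_contra h
    exact (hopen.measure_pos MeasureTheory.volume (nonempty_iff_ne_empty.2 h)).ne'
      (MeasureTheory.measure_mono_null hsub hN)
  have hPQ : P ⊆ Q := by
    rw [← hP.closure_interior]
    exact closure_minimal (sdiff_eq_empty.1 hempty) hQ
  exact mem_iUnion.1 (hPQ hx)

theorem vertex_mem_frontier (hP : IsRegion poly P) (hK : IsTriangulation poly P K) (T : Tri K)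
    {v : Plane} (hv : v ∈ T.1) : v ∈ frontier P := by
  obtain ⟨i, hi⟩ := hK.vertices_subset (T.mem_vertices hv)
  rw [hP.frontier_eq]
  refine mem_iUnion.2 ⟨i, ?_⟩
  rw [edgeSet_eq_segment, ← hi]
  exact left_mem_segment _ _ _

/-- The triangles at a vertex form a single fan. -/
theorem fan (hpoly : IsSimple poly) (hP : IsRegion poly P) (hK : IsTriangulation poly P K)
    {v : Plane} (A : Set (Tri K)) {T₀ : Tri K} (hT₀ : T₀ ∈ A) (hvT₀ : v ∈ T₀.1)
    (hA : ∀ S ∈ A, ∀ T, v ∈ S.1 → v ∈ T.1 → (dualGraph K).Adj S T → T ∈ A)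
    {T₁ : Tri K} (hvT₁ : v ∈ T₁.1) : T₁ ∈ A := by
  by_contra hT₁
  have := hK.finite_tri
  have hclosed : ∀ B : Set (Tri K), IsClosed (⋃ T ∈ B, T.carrier) := fun B =>
    B.toFinite.isClosed_biUnion fun T _ => T.isClosed_carrier
  let PA : Set Plane := ⋃ T ∈ {T | T ∈ A ∧ v ∈ T.1}, T.carrier
  let PB : Set Plane := ⋃ T ∈ {T | T ∉ A ∧ v ∈ T.1}, T.carrier
  let PC : Set Plane := ⋃ T ∈ {T : Tri K | v ∉ T.1}, T.carrier
  have hvC : v ∉ PC := by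
    simp only [PC, mem_iUnion, not_exists]
    exact fun T hT h => hT (Tri.mem_of_vertex_mem_carrier hvT₀ h)
  obtain ⟨ε₀, hε₀, hball⟩ := Metric.isOpen_iff.1 (hclosed {T | v ∉ T.1}).isOpen_compl v hvC
  obtain ⟨i, hi⟩ := hK.vertices_subset (T₀.mem_vertices hvT₀)
  obtain ⟨ε, hε, hle, S₁, S₂, hS₁, hS₂, hS⟩ := exists_sectors_of_vertex hpoly i hε₀
  rw [show poly i = v from hi, ← hP.frontier_eq] at hS
  have hPcl : IsClosed P := hP.isCompact.isClosed
  -- A second common corner would make the two triangles adjacent at `v`, and `hA` would put the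
  -- second one into `A`.
  have hAB : PA ∩ PB ⊆ {v} := by
    rintro x ⟨hxA, hxB⟩
    obtain ⟨S, ⟨hSA, hvS⟩, hxS⟩ := mem_iUnion₂.1 hxA
    obtain ⟨T, ⟨hTA, hvT⟩, hxT⟩ := mem_iUnion₂.1 hxB
    have hint : ∀ w, w ∈ S.1 → w ∈ T.1 → w = v := by
      intro w hw hw'
      by_contra hne
      refine hTA (hA S hSA T hvS hvT (dualGraph_adj_of_mem ?_ hne hw hw' hvS hvT))
      rintro rfl
      exact hTA hSA
    classical
    have := Tri.mem_convexHull_inter hxS hxT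
    have hsub : ((S.1 ∩ T.1 : Finset Plane) : Set Plane) ⊆ {v} := by
      intro w hw
      simp only [Finset.coe_inter, mem_inter_iff, Finset.mem_coe] at hw
      exact hint w hw.1 hw.2
    simpa using convexHull_mono hsub this
  have hcov : ∀ x ∈ Metric.ball v ε, x ∈ P → x ∈ PA ∪ PB := by
    intro x hx hxP
    obtain ⟨T, hT⟩ := hK.exists_tri hP hxP
    have hvT : v ∈ T.1 := by
      by_contra hvT
      exact hball (Metric.ball_subset_ball hle hx)
        (mem_biUnion (show T ∈ {T : Tri K | v ∉ T.1} from hvT) hT)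
    by_cases h : T ∈ A
    · exact .inl (mem_biUnion (show T ∈ {T | T ∈ A ∧ v ∈ T.1} from ⟨h, hvT⟩) hT)
    · exact .inr (mem_biUnion (show T ∈ {T | T ∉ A ∧ v ∈ T.1} from ⟨h, hvT⟩) hT)
  have hsubP : ∀ B : Set (Tri K), (⋃ T ∈ B, T.carrier) ⊆ P := fun B =>
    iUnion₂_subset fun T _ => T.carrier_subset hK
  have hvJ : v ∈ frontier P := vertex_mem_frontier hP hK T₀ hvT₀
  -- a sector meeting one of the two families lies in it
  have hclopen : ∀ Q Q' : Set Plane, IsClosed Q → IsClosed Q' → Q ⊆ P → Q ∩ Q' ⊆ {v} →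
      (∀ x ∈ Metric.ball v ε, x ∈ P → x ∈ Q ∪ Q') → ∀ S, S = S₁ ∨ S = S₂ →
      (S ∩ Q).Nonempty → S ⊆ Q := by
    intro Q Q' hQ hQ' hQP hQQ' hc S hSS hne
    have hSsub : S ⊆ Metric.ball v ε \ frontier P := by
      rw [← hS]; rcases hSS with rfl | rfl
      · exact subset_union_left
      · exact subset_union_right
    have hSp : IsPreconnected S := by rcases hSS with rfl | rfl <;> assumption
    have hint : S ∩ Q ⊆ interior Q := by
      rintro x ⟨hxS, hxQ⟩
      have hxI : x ∈ interior P := by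
        by_contra h
        exact (hSsub hxS).2 (by rw [hPcl.frontier_eq]; exact ⟨hQP hxQ, h⟩)
      have hxQ' : x ∉ Q' := fun h => (hSsub hxS).2 (by rw [hQQ' ⟨hxQ, h⟩]; exact hvJ)
      rw [mem_interior_iff_mem_nhds]
      filter_upwards [mem_interior_iff_mem_nhds.1 hxI, hQ'.isOpen_compl.mem_nhds hxQ',
        Metric.isOpen_ball.mem_nhds (hSsub hxS).1] with y h1 h2 h3
      exact (hc y h3 h1).resolve_right h2
    have := hSp.subset_left_of_subset_union isOpen_interior hQ.isOpen_compl
      (disjoint_compl_right.mono_left interior_subset) (fun x hx => by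
        by_cases hxQ : x ∈ Q
        · exact .inl (hint ⟨hx, hxQ⟩)
        · exact .inr hxQ) (by
        obtain ⟨x, hx⟩ := hne
        exact ⟨x, hx.1, hint hx⟩)
    exact this.trans interior_subset
  have hmeet : ∀ (Q : Set Plane) (T : Tri K), v ∈ T.1 → T.carrier ⊆ Q →
      ∃ S, (S = S₁ ∨ S = S₂) ∧ (S ∩ Q).Nonempty := by
    intro Q T hvT hTQ
    have hvc := T.carrier_subset_closure_interior (T.subset_carrier hvT)
    have hopen : IsOpen (Metric.ball v ε ∩ interior T.carrier) :=
      Metric.isOpen_ball.inter isOpen_interior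
    have hne : (Metric.ball v ε ∩ interior T.carrier).Nonempty :=
      mem_closure_iff.1 hvc _ Metric.isOpen_ball (Metric.mem_ball_self hε)
    have hnot : ¬ (Metric.ball v ε ∩ interior T.carrier ⊆ frontier P) := by
      intro hsub
      have := interior_maximal hsub hopen
      rw [interior_frontier hPcl] at this
      exact hne.not_subset_empty this
    obtain ⟨x, hx, hxJ⟩ := not_subset.1 hnot
    have hxS : x ∈ S₁ ∪ S₂ := by rw [hS]; exact ⟨hx.1, hxJ⟩
    rcases hxS with h | h
    · exact ⟨S₁, .inl rfl, x, h, hTQ (interior_subset hx.2)⟩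
    · exact ⟨S₂, .inr rfl, x, h, hTQ (interior_subset hx.2)⟩
  obtain ⟨SA, hSA, hSAne⟩ := hmeet PA T₀ hvT₀
    (subset_biUnion_of_mem (u := fun T : Tri K => T.carrier)
      (show T₀ ∈ {T | T ∈ A ∧ v ∈ T.1} from ⟨hT₀, hvT₀⟩))
  obtain ⟨SB, hSB, hSBne⟩ := hmeet PB T₁ hvT₁
    (subset_biUnion_of_mem (u := fun T : Tri K => T.carrier)
      (show T₁ ∈ {T | T ∉ A ∧ v ∈ T.1} from ⟨hT₁, hvT₁⟩))
  have hA' := hclopen PA PB (hclosed _) (hclosed _) (hsubP _) hAB hcov SA hSA hSAne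
  have hB' := hclopen PB PA (hclosed _) (hclosed _) (hsubP _) (by rwa [inter_comm])
    (fun x h1 h2 => (hcov x h1 h2).symm) SB hSB hSBne
  -- The families occupy different sectors, and there are at most two. Hence both sectors lie in
  -- `P`, which makes `v` an interior point, although it is a vertex of the polygon.
  have hunion : S₁ ∪ S₂ ⊆ P := by
    have hne : SA ≠ SB := by
      rintro rfl
      obtain ⟨x, hx, hxA⟩ := hSAne
      have hxv : x = v := hAB ⟨hxA, hB' hx⟩
      have : x ∈ S₁ ∪ S₂ := by rcases hSA with rfl | rfl <;> simp [hx]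
      rw [hS] at this
      exact this.2 (hxv ▸ hvJ)
    have h1 : SA ⊆ P := hA'.trans (hsubP _)
    have h2 : SB ⊆ P := hB'.trans (hsubP _)
    rcases hSA with rfl | rfl <;> rcases hSB with rfl | rfl
    · exact (hne rfl).elim
    · exact union_subset h1 h2
    · exact union_subset h2 h1
    · exact (hne rfl).elim
  have hballP : Metric.ball v ε ⊆ P := by
    intro x hx
    by_cases hxJ : x ∈ frontier P
    · exact hPcl.frontier_subset hxJ
    · exact hunion (by rw [hS]; exact ⟨hx, hxJ⟩)
  have hvI : v ∈ interior P := interior_maximal hballP Metric.isOpen_ball (Metric.mem_ball_self hε)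
  rw [hPcl.frontier_eq] at hvJ
  exact hvJ.2 hvI

/-! ### Gates -/

theorem gate_comm (S T : Tri K) : gate S T = gate T S := by
  classical
  exact congrArg (Finset.centroid ℝ · id) (Finset.inter_comm S.1 T.1)

theorem co_gate {S T : Tri K} (h : (dualGraph K).Adj S T) {v : Plane} (hS : v ∈ S.1)
    (hT : v ∈ T.1) : S.co v (gate S T) = 1 / 2 := by
  classical
  obtain ⟨a, b, c, d, hab, hac, hbc, had, hbd, hc, hd, hSe, hTe, hI⟩ := dualGraph_adj_iff.1 h
  have hv : v ∈ S.1 ∩ T.1 := Finset.mem_inter.2 ⟨hS, hT⟩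
  have ha : a ∈ S.1 := by simp [hSe]
  have hb : b ∈ S.1 := by simp [hSe]
  rw [gate_eq hI, AffineMap.apply_lineMap, AffineMap.lineMap_apply_ring]
  rw [hI, Finset.mem_insert, Finset.mem_singleton] at hv
  rcases hv with rfl | rfl
  · rw [S.co_self ha, S.co_of_ne hb hab]; norm_num
  · rw [S.co_self hb, S.co_of_ne ha hab.symm]; norm_num

theorem gate_mem_left {S T : Tri K} (h : (dualGraph K).Adj S T) : gate S T ∈ S.carrier := by
  classical
  obtain ⟨a, b, c, d, hab, hac, hbc, had, hbd, hc, hd, hSe, hTe, hI⟩ := dualGraph_adj_iff.1 h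
  rw [gate_eq hI]
  exact S.convex_carrier.lineMap_mem (S.subset_carrier (by simp [hSe]))
    (S.subset_carrier (by simp [hSe])) ⟨by norm_num, by norm_num⟩

theorem gate_mem_right {S T : Tri K} (h : (dualGraph K).Adj S T) : gate S T ∈ T.carrier := by
  rw [gate_comm]
  exact gate_mem_left h.symm

/-- On the way from a point of a triangle to a gate, the coordinates with respect to the corners of
the gate are positive. -/
theorem co_lineMap_gate_pos {S T : Tri K} (h : (dualGraph K).Adj S T) {y : Plane}
    (hy : y ∈ S.carrier) {θ : ℝ} (h0 : 0 < θ) (h1 : θ ≤ 1) {v : Plane} (hS : v ∈ S.1)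
    (hT : v ∈ T.1) : 0 < S.co v (AffineMap.lineMap y (gate S T) θ) := by
  rw [AffineMap.apply_lineMap, AffineMap.lineMap_apply_ring, co_gate h hS hT]
  have := S.mem_carrier_iff.1 hy v hS
  have : 0 ≤ 1 - θ := by linarith
  positivity

/-- Any triangle containing `x` must have both corners of the common edge, and an edge belongs to at
most two triangles. -/
theorem eq_or_eq_of_co_pos {S T U : Tri K} (h : (dualGraph K).Adj S T) {x : Plane}
    (hx : x ∈ S.carrier) (hpos : ∀ v ∈ S.1, v ∈ T.1 → 0 < S.co v x) (hU : x ∈ U.carrier) :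
    U = S ∨ U = T := by
  classical
  obtain ⟨a, b, c, d, hab, hac, hbc, had, hbd, hc, hd, hSe, hTe, hI⟩ := dualGraph_adj_iff.1 h
  have haS : a ∈ S.1 := by simp [hSe]
  have hbS : b ∈ S.1 := by simp [hSe]
  have haT : a ∈ T.1 := by simp [hTe]
  have hbT : b ∈ T.1 := by simp [hTe]
  exact Tri.eq_or_eq_of_edge h.ne hab haS hbS haT hbT
    (Tri.mem_of_co_pos hU hx (hpos a haS haT)) (Tri.mem_of_co_pos hU hx (hpos b hbS hbT))

theorem mem_interior_of_co_pos (hK : IsTriangulation poly P K) {S T : Tri K}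
    (h : (dualGraph K).Adj S T) {x : Plane} (hx : x ∈ S.carrier)
    (hpos : ∀ v ∈ S.1, v ∈ T.1 → 0 < S.co v x) : x ∈ interior P := by
  classical
  obtain ⟨a, b, c, d, hab, hac, hbc, had, hbd, hc, hd, hSe, hTe, hI⟩ := dualGraph_adj_iff.1 h
  exact interior_mono (union_subset (S.carrier_subset hK) (T.carrier_subset hK))
    (Tri.mem_interior_union hab hac hbc had hbd hd hSe hTe hx
      (hpos a (by simp [hSe]) (by simp [hTe])) (hpos b (by simp [hSe]) (by simp [hTe])))

theorem segment_gate_subset_interior (hK : IsTriangulation poly P K) {S T U : Tri K}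
    (hT : (dualGraph K).Adj S T) (hU : (dualGraph K).Adj S U) :
    segment ℝ (gate S T) (gate S U) ⊆ interior P := by
  have hgT := gate_mem_left hT
  have hgU := gate_mem_left hU
  rw [segment_eq_image_lineMap]
  rintro _ ⟨θ, ⟨h0, h1⟩, rfl⟩
  rcases h0.eq_or_lt with rfl | h0
  · rw [AffineMap.lineMap_apply_zero]
    refine mem_interior_of_co_pos hK hT hgT fun v hv hv' => ?_
    rw [co_gate hT hv hv']; norm_num
  · exact mem_interior_of_co_pos hK hU (S.convex_carrier.lineMap_mem hgT hgU ⟨h0.le, h1⟩)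
      fun v hv hv' => co_lineMap_gate_pos hU hgT h0 h1 hv hv'

theorem mem_of_adj_of_notMem {S T : Tri K} (h : (dualGraph K).Adj S T) {a b c : Plane}
    (hS : S.1 = {a, b, c}) (hc : c ∉ T.1) : a ∈ T.1 ∧ b ∈ T.1 := by
  classical
  obtain ⟨p, q, c', d', hpq, -, -, -, -, -, -, hSe, hTe, -⟩ := dualGraph_adj_iff.1 h
  have hp : p ∈ S.1 := by simp [hSe]
  have hq : q ∈ S.1 := by simp [hSe]
  have hp' : p ∈ T.1 := by simp [hTe]
  have hq' : q ∈ T.1 := by simp [hTe]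
  rw [hS] at hp hq
  simp only [Finset.mem_insert, Finset.mem_singleton] at hp hq
  rcases hp with rfl | rfl | rfl <;> rcases hq with rfl | rfl | rfl <;> tauto

/-! ### The dual graph has no cycles -/

/-- There is a path of triangles from `x` to `y` avoiding `t`. -/
def Reach (t x y : Tri K) : Prop := ∃ w : (dualGraph K).Walk x y, t ∉ w.support

/-- Consecutive gates belong to one triangle of the walk, and the segment between them avoids the
frontier. This supplies the closed chain for `separation`. -/
theorem chain_waypoints (hK : IsTriangulation poly P K) {A : Set (Tri K)} {e f : Tri K}
    (hf : (dualGraph K).Adj e f) : ∀ {x : Tri K} (w : (dualGraph K).Walk x e) (s : Tri K)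
      (_ : (dualGraph K).Adj s x) (_ : ∀ T ∈ w.support, T ∈ A),
      ChainRel (fun y z => ∃ T ∈ A, segment ℝ y z ⊆ T.carrier ∩ interior P) (gate s x)
        (waypoints w ++ [gate e f])
  | x, .nil, s, hs, hA => by
    refine ⟨⟨x, hA x (by simp), subset_inter ?_ ?_⟩, trivial⟩
    · exact x.convex_carrier.segment_subset (gate_mem_right hs) (gate_mem_left hf)
    · rw [gate_comm]
      exact segment_gate_subset_interior hK hs.symm hf
  | x, .cons (v := y) h w, s, hs, hA => by
    refine ⟨⟨x, hA x (by simp), subset_inter ?_ ?_⟩,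
      chain_waypoints hK hf w x h fun T hT => hA T (by simp [hT])⟩
    · exact x.convex_carrier.segment_subset (gate_mem_right hs) (gate_mem_left h)
    · rw [gate_comm]
      exact segment_gate_subset_interior hK hs.symm h

/-- Different neighbours of a triangle `t` are not connected by a path avoiding `t`. -/
theorem not_reach (hP : IsRegion poly P) (hK : IsTriangulation poly P K)
    {t t' t'' : Tri K} (h' : (dualGraph K).Adj t t') (h'' : (dualGraph K).Adj t t'')
    (hne : t' ≠ t'') : ¬ Reach t t' t'' := by
  classical
  rintro ⟨w₀, hw₀⟩
  obtain ⟨w, hw, htw⟩ : ∃ w : (dualGraph K).Walk t' t'', w.IsPath ∧ t ∉ w.support :=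
    ⟨w₀.bypass, w₀.bypass_isPath, fun h => hw₀ (w₀.support_bypass_subset_support h)⟩
  cases w with
  | nil => exact hne rfl
  | @cons _ x _ hx w =>
  rw [SimpleGraph.Walk.cons_isPath_iff] at hw
  obtain ⟨-, hw'⟩ := hw
  have htw' : t ∉ w.support := fun h => htw (by simp [h])
  have hxt : x ≠ t := by
    rintro rfl
    exact htw' (SimpleGraph.Walk.start_mem_support _)
  obtain ⟨a, b, c, d, hab, hac, hbc, had, hbd, hc, hd, ht, ht', hI⟩ := dualGraph_adj_iff.1 h'
  have ha : a ∈ t.1 := by simp [ht]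
  have hb : b ∈ t.1 := by simp [ht]
  have hcm : c ∈ t.1 := by simp [ht]
  have ha' : a ∈ t'.1 := by simp [ht']
  have hb' : b ∈ t'.1 := by simp [ht']
  have hdm : d ∈ t'.1 := by simp [ht']
  -- The affine chart sending `a`, `b`, `c` to 0, 1, `i`: the edge becomes the segment from 0 to 1
  -- and the gate of `t` and `t'` becomes `1 / 2`.
  let Φ : Plane →ᵃ[ℝ] ℂ :=
    Complex.equivRealProdLm.symm.toLinearMap.toAffineMap.comp ((t.co b).prod (t.co c))
  have hre : ∀ y, (Φ y).re = t.co b y := fun y => rfl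
  have him : ∀ y, (Φ y).im = t.co c y := fun y => rfl
  have hΦinj : Function.Injective Φ := by
    intro y z hyz
    have h1 : t.co b y = t.co b z := congrArg Complex.re hyz
    have h2 : t.co c y = t.co c z := congrArg Complex.im hyz
    have hs : ∀ y, t.co a y + (t.co b y + t.co c y) = 1 := by
      intro y
      have := t.sum_co y
      rwa [ht, Finset.sum_insert (by simp [hab, hac]), Finset.sum_insert (by simp [hbc]),
        Finset.sum_singleton] at this
    have h3 : t.co a y = t.co a z := by linarith [hs y, hs z]
    rw [← t.sum_co_smul y, ← t.sum_co_smul z]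
    refine Finset.sum_congr rfl fun v hv => ?_
    rw [ht] at hv
    simp only [Finset.mem_insert, Finset.mem_singleton] at hv
    rcases hv with rfl | rfl | rfl
    · rw [h3]
    · rw [h1]
    · rw [h2]
  have hΦc : Continuous Φ := AffineMap.continuous_of_finiteDimensional _
  have hΦa : Φ a = 0 := Complex.ext (by rw [hre, t.co_of_ne ha hab.symm]; rfl)
    (by rw [him, t.co_of_ne ha hac.symm]; rfl)
  have hΦb : Φ b = 1 := Complex.ext (by rw [hre, t.co_self hb]; rfl)
    (by rw [him, t.co_of_ne hb hbc.symm]; rfl)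
  have hΦg : Φ (gate t t') = 1 / 2 := by
    rw [gate_eq hI, AffineMap.apply_lineMap, hΦa, hΦb, AffineMap.lineMap_apply]
    simp
  have hJ : ∀ {y}, y ∈ interior P → y ∉ frontier P := fun hy h => h.2 hy
  have hfa := vertex_mem_frontier hP hK t ha
  have hfb := vertex_mem_frontier hP hK t hb
  refine separation (S := Φ '' frontier P) (u := Φ (gate t'' t)) (u' := Φ (gate t' x))
    (l := (waypoints w ++ [gate t'' t]).map Φ) ?_ ⟨a, hfa, hΦa⟩ ⟨b, hfb, hΦb⟩ ?_ ?_ ?_ ?_ ?_ ?_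
  · rw [hP.frontier_eq]
    exact (isPreconnected_boundary poly).image _ hΦc.continuousOn
  -- Without `c`, the triangle `t''` would be a third one on the edge `ab`. So its gate with `t`
  -- lies strictly on the side of `c`; likewise the gate of `t'` and `x` lies strictly on the side
  -- of `d`.
  · have hc'' : c ∈ t''.1 := by
      by_contra hc''
      obtain ⟨h1, h2⟩ := mem_of_adj_of_notMem h'' ht hc''
      rcases Tri.eq_or_eq_of_edge h'.ne hab ha hb ha' hb' h1 h2 with h | h
      · exact h''.ne h.symm
      · exact hne h.symm
    rw [him, gate_comm, co_gate h'' hcm hc'']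
    norm_num
  · have hdx : d ∈ x.1 := by
      by_contra hdx
      obtain ⟨h1, h2⟩ := mem_of_adj_of_notMem hx ht' hdx
      rcases Tri.eq_or_eq_of_edge h'.ne hab ha hb ha' hb' h1 h2 with h | h
      · exact hxt h
      · exact hx.ne h.symm
    rw [him, Tri.co_eq_mul hab hac hbc had hbd ht ht', co_gate hx hdm hdx]
    have := Tri.co_neg_of_adj hab had hbd hd ht ht'
    linarith
  · simp
  · rw [← hΦa, ← hΦb, ← image_segment ℝ Φ a b, ← image_union]
    refine ChainRel.mono (r := fun y z => ∃ T ∈ {T | T ∈ w.support},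
      segment ℝ y z ⊆ T.carrier ∩ interior P) Φ ?_ (chain_waypoints hK h''.symm w t' hx
      fun T hT => hT)
    rintro y z ⟨T, hT, hyz⟩
    rw [← image_segment ℝ Φ y z, Set.disjoint_image_iff hΦinj, Set.disjoint_left]
    intro p hp
    obtain ⟨hpT, hpI⟩ := hyz hp
    rintro (hpJ | hpab)
    · exact hJ hpI hpJ
    · rw [segment_eq_image_lineMap] at hpab
      obtain ⟨θ, ⟨hθ0, hθ1⟩, rfl⟩ := hpab
      have hθ0' : θ ≠ 0 := by
        rintro rfl
        rw [AffineMap.lineMap_apply_zero] at hpI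
        exact hJ hpI hfa
      have hθ1' : θ ≠ 1 := by
        rintro rfl
        rw [AffineMap.lineMap_apply_one] at hpI
        exact hJ hpI hfb
      -- A point of the open edge `ab` lies only in `t` and `t'`, and the rest of the path visits
      -- neither.
      have hpt : AffineMap.lineMap a b θ ∈ t.carrier :=
        t.convex_carrier.lineMap_mem (t.subset_carrier ha) (t.subset_carrier hb) ⟨hθ0, hθ1⟩
      have h1 : a ∈ T.1 := by
        refine Tri.mem_of_co_pos hpT hpt ?_
        rw [AffineMap.apply_lineMap, AffineMap.lineMap_apply_ring, t.co_self ha,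
          t.co_of_ne hb hab]
        have := lt_of_le_of_ne hθ1 hθ1'
        linarith
      have h2 : b ∈ T.1 := by
        refine Tri.mem_of_co_pos hpT hpt ?_
        rw [AffineMap.apply_lineMap, AffineMap.lineMap_apply_ring, t.co_self hb,
          t.co_of_ne ha hab.symm]
        have := lt_of_le_of_ne hθ0 hθ0'.symm
        linarith
      rcases Tri.eq_or_eq_of_edge h'.ne hab ha hb ha' hb' h1 h2 with rfl | rfl
      · exact htw' hT
      · exact hw' hT
  · rw [← hΦg, ← image_segment ℝ Φ, Set.disjoint_image_iff hΦinj, Set.disjoint_left, gate_comm]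
    exact fun y hy => hJ (segment_gate_subset_interior hK h'' h' hy)
  · rw [← hΦg, ← image_segment ℝ Φ, Set.disjoint_image_iff hΦinj, Set.disjoint_left, gate_comm]
    exact fun y hy => hJ (segment_gate_subset_interior hK h'.symm hx hy)

/-! ### The parts into which a triangle divides the region -/

theorem Reach.ne_right {t x y : Tri K} (h : Reach t x y) : y ≠ t := by
  obtain ⟨w, hw⟩ := h
  rintro rfl
  exact hw w.end_mem_support

theorem Reach.refl {t x : Tri K} (h : x ≠ t) : Reach t x x :=
  ⟨.nil, by simpa using h.symm⟩

theorem Reach.symm {t x y : Tri K} (h : Reach t x y) : Reach t y x := by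
  obtain ⟨w, hw⟩ := h
  exact ⟨w.reverse, by simpa using hw⟩

theorem Reach.trans {t x y z : Tri K} (h : Reach t x y) (h' : Reach t y z) : Reach t x z := by
  obtain ⟨w, hw⟩ := h
  obtain ⟨w', hw'⟩ := h'
  exact ⟨w.append w', by rw [SimpleGraph.Walk.mem_support_append_iff]; tauto⟩

theorem Reach.of_adj {t x y : Tri K} (hx : x ≠ t) (hy : y ≠ t) (h : (dualGraph K).Adj x y) :
    Reach t x y :=
  ⟨.cons h .nil, by simp [hx.symm, hy.symm]⟩

/-- The triangles beyond a neighbour `t'` of `t`, as seen from `t`. -/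
def region (t t' : Tri K) : Set Plane := ⋃ e ∈ {e | Reach t t' e}, e.carrier

/-- The triangles other than `t` that are not beyond the neighbour `t'` of `t`. -/
def coregion (t t' : Tri K) : Set Plane := ⋃ e ∈ {e | e ≠ t ∧ ¬ Reach t t' e}, e.carrier

theorem mem_region {t t' : Tri K} {x : Plane} :
    x ∈ region t t' ↔ ∃ e, Reach t t' e ∧ x ∈ e.carrier := by
  simp [region]

theorem mem_coregion {t t' : Tri K} {x : Plane} :
    x ∈ coregion t t' ↔ ∃ e, e ≠ t ∧ ¬ Reach t t' e ∧ x ∈ e.carrier := by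
  simp [coregion, and_assoc]

theorem isClosed_region (hK : IsTriangulation poly P K) (t t' : Tri K) :
    IsClosed (region t t') := by
  have := hK.finite_tri
  exact (Set.toFinite _).isClosed_biUnion fun T _ => T.isClosed_carrier

theorem isClosed_coregion (hK : IsTriangulation poly P K) (t t' : Tri K) :
    IsClosed (coregion t t') := by
  have := hK.finite_tri
  exact (Set.toFinite _).isClosed_biUnion fun T _ => T.isClosed_carrier

/-- Triangles with a common point outside `t` are connected by a path avoiding `t`. -/
theorem reach_of_mem (hpoly : IsSimple poly) (hP : IsRegion poly P) (hK : IsTriangulation poly P K)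
    {t e f : Tri K} (he : e ≠ t) (hf : f ≠ t) {x : Plane} (hxe : x ∈ e.carrier)
    (hxf : x ∈ f.carrier) (hxt : x ∉ t.carrier) : Reach t e f := by
  classical
  by_contra hnr
  have hef : e ≠ f := by
    rintro rfl
    exact hnr (Reach.refl he)
  have hx := Tri.mem_convexHull_inter hxe hxf
  obtain ⟨v, hv⟩ : (e.1 ∩ f.1).Nonempty := by
    rw [Finset.nonempty_iff_ne_empty]
    intro h
    rw [h] at hx
    simp at hx
  rw [Finset.mem_inter] at hv
  have hsub : ((e.1 ∩ f.1 : Finset Plane) : Set Plane) ⊆ {v} := by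
    intro w hw
    simp only [Finset.coe_inter, mem_inter_iff, Finset.mem_coe] at hw
    by_contra hwv
    exact hnr (Reach.of_adj he hf (dualGraph_adj_of_mem hef hwv hw.1 hw.2 hv.1 hv.2))
  have hxv : x = v := by simpa using convexHull_mono hsub hx
  subst hxv
  -- All triangles at the common corner `x` are reached from `e` by turning around `x`; none of them
  -- is `t`, because `x` is outside `t`.
  refine hnr (fan hpoly hP hK {T | Reach t e T} (Reach.refl he) hv.1 ?_ hv.2)
  intro S hS T _ hT hST
  refine Reach.trans hS (Reach.of_adj (Reach.ne_right hS) ?_ hST)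
  rintro rfl
  exact hxt (Tri.subset_carrier _ hT)

theorem region_inter_coregion (hpoly : IsSimple poly) (hP : IsRegion poly P)
    (hK : IsTriangulation poly P K) {t t' : Tri K} {x : Plane} (h1 : x ∈ region t t')
    (h2 : x ∈ coregion t t') : x ∈ t.carrier := by
  by_contra hxt
  obtain ⟨e, he, hxe⟩ := mem_region.1 h1
  obtain ⟨f, hf, hnf, hxf⟩ := mem_coregion.1 h2
  exact hnf (he.trans (reach_of_mem hpoly hP hK he.ne_right hf hxe hxf hxt))

theorem mem_region_or_coregion (hP : IsRegion poly P) (hK : IsTriangulation poly P K)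
    (t t' : Tri K) {x : Plane} (hx : x ∈ P) (hxt : x ∉ t.carrier) :
    x ∈ region t t' ∨ x ∈ coregion t t' := by
  obtain ⟨e, he⟩ := hK.exists_tri hP hx
  by_cases h : Reach t t' e
  · exact .inl (mem_region.2 ⟨e, h, he⟩)
  · refine .inr (mem_coregion.2 ⟨e, ?_, h, he⟩)
    rintro rfl
    exact hxt he

/-- Off `t`, the closed sets `region` and `coregion` are disjoint and cover `P`, so a connected set
avoiding `t` stays in one of them. -/
theorem segment_subset_region (hpoly : IsSimple poly) (hP : IsRegion poly P)
    (hK : IsTriangulation poly P K) {t t' : Tri K} {x y : Plane} (hx : x ∈ region t t')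
    (hsP : segment ℝ x y ⊆ P) (hst : ∀ z ∈ segment ℝ x y, z ∉ t.carrier) : y ∈ region t t' := by
  by_contra hy
  have hy' := (mem_region_or_coregion hP hK t t' (hsP (right_mem_segment _ _ _))
    (hst y (right_mem_segment _ _ _))).resolve_left hy
  obtain ⟨z, hz, hz1, hz2⟩ := isPreconnected_closed_iff.1 (convex_segment x y).isPreconnected _ _
    (isClosed_region hK t t') (isClosed_coregion hK t t')
    (fun z hz => mem_region_or_coregion hP hK t t' (hsP hz) (hst z hz))
    ⟨x, left_mem_segment _ _ _, hx⟩ ⟨y, right_mem_segment _ _ _, hy'⟩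
  exact hst z hz (region_inter_coregion hpoly hP hK hz1 hz2)

/-! ### The puppy cannot pass the triangle of the human -/

/-- By convexity the segment from `x` to `h` stays in `T`, and moving along it decreases the
distance at once. -/
theorem eq_of_isStable (hK : IsTriangulation poly P K) {T : Tri K} {h x : Plane}
    (hs : IsStable P h x) (hx : x ∈ T.carrier) (hh : h ∈ T.carrier) : x = h := by
  by_contra hne
  have hpos := dist_pos.2 hne
  have hlim : Tendsto (fun ε : ℝ => AffineMap.lineMap x h ε) (𝓝[>] 0) (𝓝[P] x) := by
    refine tendsto_nhdsWithin_iff.2 ⟨?_, ?_⟩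
    · have hc : Continuous (fun ε : ℝ => (AffineMap.lineMap x h ε : Plane)) :=
        AffineMap.lineMap_continuous
      have := hc.tendsto 0
      rw [AffineMap.lineMap_apply_zero] at this
      exact this.mono_left nhdsWithin_le_nhds
    · filter_upwards [Ioo_mem_nhdsGT (show (0 : ℝ) < 1 by norm_num)] with ε hε
      exact T.carrier_subset hK (T.convex_carrier.lineMap_mem hx hh ⟨hε.1.le, hε.2.le⟩)
  obtain ⟨ε, h1, h2⟩ := ((hlim.eventually hs.2).and
    (Ioo_mem_nhdsGT (show (0 : ℝ) < 1 by norm_num))).exists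
  simp only [dist_lineMap_right] at h1
  rw [Real.norm_of_nonneg (by linarith [h2.2])] at h1
  nlinarith [h2.1]

theorem not_canApproach_imp_eq (hK : IsTriangulation poly P K) {T : Tri K} {h x : Plane}
    (hx : x ∈ T.carrier) (hh : h ∈ T.carrier) (hn : ¬ CanApproach P h x) : x = h := by
  by_contra hne
  exact hn ⟨h, right_mem_segment _ _ _, Ne.symm hne,
    (T.convex_carrier.segment_subset hx hh).trans (T.carrier_subset hK)⟩

/-- A greedy move that meets the triangle of the human ends in it. -/
theorem GreedyMove.mem_carrier (hK : IsTriangulation poly P K) {T : Tri K} {h x y z : Plane}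
    (hm : GreedyMove P h x y) (hh : h ∈ T.carrier) (hz : z ∈ segment ℝ x y)
    (hzT : z ∈ T.carrier) : y ∈ T.carrier := by
  cases hm with
  | straight _ hy _ =>
    rw [segment_eq_image_lineMap] at hz hy
    obtain ⟨s, ⟨hs0, hs1⟩, rfl⟩ := hy
    obtain ⟨r, ⟨hr0, hr1⟩, rfl⟩ := hz
    have hrs : r * s ≤ s := mul_le_of_le_one_left hs0 hr1
    have hz' : (AffineMap.lineMap x (AffineMap.lineMap x h s) r : Plane) =
        AffineMap.lineMap x h (r * s) := by
      simp [AffineMap.lineMap_apply, mul_smul]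
    rw [hz'] at hzT
    rcases hs1.eq_or_lt with rfl | hs1
    · simpa using hh
    have h1 : 0 < 1 - r * s := by linarith
    -- The meeting point comes before `y` on the way to `h`, so `y` lies between it and `h`; the
    -- ratio is the one that places `y` there.
    have : (AffineMap.lineMap x h s : Plane) =
        AffineMap.lineMap (AffineMap.lineMap x h (r * s)) h ((s - r * s) / (1 - r * s)) := by
      simp only [AffineMap.lineMap_apply, vsub_eq_sub, vadd_eq_add]
      have e1 : h - (r * s) • (h - x) - x = (1 - r * s) • (h - x) := by module
      have e2 : h - ((r * s) • (h - x) + x) = (1 - r * s) • (h - x) := by module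
      rw [e2, smul_smul, div_mul_cancel₀ _ h1.ne']
      module
    rw [this]
    exact T.convex_carrier.lineMap_mem hzT hh
      ⟨div_nonneg (by linarith) h1.le, (div_le_one h1).2 (by linarith)⟩
  | slide _ _ _ hna hanti =>
    by_contra hy
    have hzy : z ≠ y := by
      rintro rfl
      exact hy hzT
    -- A point of `T` from which the human cannot be approached is the human's position; there the
    -- distance is 0 and the slide cannot decrease it further.
    have hzh := not_canApproach_imp_eq hK hzT hh (hna z hz hzy)
    subst hzh
    rw [segment_eq_image_lineMap] at hz
    obtain ⟨r, hr, hrz⟩ := hz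
    have hr1 : r < 1 := by
      refine lt_of_le_of_ne hr.2 ?_
      rintro rfl
      rw [AffineMap.lineMap_apply_one] at hrz
      exact hzy hrz.symm
    have h1 := hanti hr (right_mem_Icc.2 zero_le_one) hr1
    simp only [hrz, dist_self] at h1
    exact absurd h1 (not_lt.2 dist_nonneg)

theorem GreedyMove.segment_subset {h x y : Plane} (hm : GreedyMove P h x y) :
    segment ℝ x y ⊆ P := by
  cases hm <;> assumption

theorem GreedyRun.mem_region (hpoly : IsSimple poly) (hP : IsRegion poly P)
    (hK : IsTriangulation poly P K) {t t' : Tri K} {h x y : Plane}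
    (hr : GreedyRun P h x y) (hh : h ∈ t.carrier) (hx : x ∈ region t t')
    (hne : h ≠ y) : y ∈ region t t' := by
  obtain ⟨hr, hs⟩ := hr
  -- Intermediate positions may enter `t`, and then remain there; only the final, stable position is
  -- excluded from `t`.
  have : y ∈ t.carrier ∨ y ∈ region t t' := by
    clear hs hne
    induction hr with
    | refl => exact .inr hx
    | @tail y z _ hm ih =>
      rcases ih with ih | ih
      · exact .inl (hm.mem_carrier hK hh (left_mem_segment _ _ _) ih)
      · by_cases hmeet : ∃ w ∈ segment ℝ y z, w ∈ t.carrier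
        · obtain ⟨w, hw, hwt⟩ := hmeet
          exact .inl (hm.mem_carrier hK hh hw hwt)
        · push Not at hmeet
          exact .inr (segment_subset_region hpoly hP hK ih hm.segment_subset hmeet)
  rcases this with h1 | h1
  · exact (hne (eq_of_isStable hK hs h1 hh).symm).elim
  · exact h1

theorem IsGreedyPuppy.isStable {p₀ : Plane} {h p : ℝ → Plane} (hp : IsGreedyPuppy P p₀ h p)
    {r : ℝ} (hr : 0 ≤ r) : IsStable P (h r) (p r) := by
  rcases hr.eq_or_lt with rfl | hr
  · exact hp.start.2
  · obtain ⟨q, _, hq⟩ := hp.run r hr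
    exact hq.2

/-- While the human walks in a triangle `t`, the puppy stays beyond the same edge of `t`. -/
theorem IsGreedyPuppy.mem_region (hpoly : IsSimple poly) (hP : IsRegion poly P)
    (hK : IsTriangulation poly P K) {p₀ : Plane} {h p : ℝ → Plane} (hp : IsGreedyPuppy P p₀ h p)
    (hne : ∀ r, 0 ≤ r → h r ≠ p r) {t t' : Tri K} {a b : ℝ} (ha : 0 ≤ a) (hab : a ≤ b)
    (hh : ∀ r ∈ Icc a b, h r ∈ t.carrier) (hpa : p a ∈ region t t') : p b ∈ region t t' := by
  by_contra hpb
  have hPcl : IsClosed P := hP.isCompact.isClosed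
  have hnt : ∀ r ∈ Icc a b, p r ∉ t.carrier := fun r hr hpt =>
    hne r (ha.trans hr.1) (eq_of_isStable hK (hp.isStable (ha.trans hr.1)) hpt (hh r hr)).symm
  let B : Set ℝ := {r | r ∈ Icc a b ∧ p r ∉ region t t'}
  have hbB : b ∈ B := ⟨right_mem_Icc.2 hab, hpb⟩
  have hBb : BddBelow B := ⟨a, fun r hr => hr.1.1⟩
  -- `m` is the first exit time. The left limit at `m` is still in the closed region, and the run
  -- from it cannot cross `t`, so the exit has not happened at `m`.
  set m := sInf B with hm
  have hmI : m ∈ Icc a b := ⟨le_csInf ⟨b, hbB⟩ fun r hr => hr.1.1, csInf_le hBb hbB⟩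
  have hbefore : ∀ r, a ≤ r → r < m → p r ∈ region t t' := by
    intro r har hrm
    by_contra hr
    exact notMem_of_lt_csInf hrm hBb ⟨⟨har, hrm.le.trans hmI.2⟩, hr⟩
  have hm0 : 0 ≤ m := ha.trans hmI.1
  have hpm : p m ∈ region t t' := by
    rcases hmI.1.eq_or_lt with h0 | h0
    · rwa [← h0]
    obtain ⟨q, hq, hrun⟩ := hp.run m (ha.trans_lt h0)
    have hev : ∀ᶠ r in 𝓝[<] m, p r ∈ region t t' := by
      filter_upwards [Ioo_mem_nhdsLT h0] with r hr
      exact hbefore r hr.1.le hr.2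
    have hqR : q ∈ region t t' := (isClosed_region hK t t').mem_of_tendsto hq hev
    exact hrun.mem_region hpoly hP hK (hh m hmI) hqR (hne m hm0)
  have hco : p m ∉ coregion t t' := fun h =>
    hnt m hmI (region_inter_coregion hpoly hP hK hpm h)
  -- The complement of `coregion` is open, so the puppy avoids `coregion` shortly after `m` too;
  -- this contradicts exit times arbitrarily close to `m`.
  have hev := (hp.right_continuous m hm0).eventually
    (((isClosed_coregion hK t t').isOpen_compl.mem_nhds hco))
  obtain ⟨δ, hδ, hball⟩ := Metric.mem_nhdsWithin_iff.1 hev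
  obtain ⟨r, hrB, hrδ⟩ := exists_lt_of_csInf_lt ⟨b, hbB⟩ (show sInf B < m + δ by rw [← hm]; linarith)
  have hmr : m ≤ r := csInf_le hBb hrB
  have hr : p r ∉ coregion t t' := hball
    ⟨by rw [Metric.mem_ball, Real.dist_eq, abs_of_nonneg (by linarith)]; linarith, hmr⟩
  exact (mem_region_or_coregion hP hK t t' (hp.isStable (hm0.trans hmr)).1
    (hnt r hrB.1)).elim hrB.2 hr

/-! ### The walk of the human -/

theorem walkAlong_zero (a : Plane) (l : List Plane) : walkAlong a l 0 = a := by
  cases l with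
  | nil => rfl
  | cons b l => rw [walkAlong, if_pos dist_nonneg, zero_div, AffineMap.lineMap_apply_zero]

theorem walkAlong_cons_of_le {a b : Plane} (l : List Plane) {r : ℝ} (h : r ≤ dist a b) :
    walkAlong a (b :: l) r = AffineMap.lineMap a b (r / dist a b) := by
  rw [walkAlong, if_pos h]

theorem walkAlong_cons_of_ge {a b : Plane} (l : List Plane) {r : ℝ} (h : dist a b ≤ r) :
    walkAlong a (b :: l) r = walkAlong b l (r - dist a b) := by
  rcases h.eq_or_lt with h | h
  · subst h
    rw [walkAlong_cons_of_le l le_rfl, sub_self, walkAlong_zero]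
    by_cases hab : a = b
    · subst hab; simp
    · rw [div_self (dist_ne_zero.2 hab), AffineMap.lineMap_apply_one]
  · rw [walkAlong, if_neg (not_le.2 h)]

/-! ### Progress -/

/-- A path from `t''` that avoids `t'` also avoids `t`, since otherwise it would join two neighbours
of `t'`. The inclusion is strict because `t'` itself is lost. -/
theorem ncard_reach_lt (hP : IsRegion poly P) (hK : IsTriangulation poly P K) {t t' t'' : Tri K}
    (h : (dualGraph K).Adj t t') (h' : (dualGraph K).Adj t' t'') (hne : t'' ≠ t) :
    {e | Reach t' t'' e}.ncard < {e | Reach t t' e}.ncard := by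
  have := hK.finite_tri
  refine Set.ncard_lt_ncard ⟨?_, fun hsub => ?_⟩ (Set.toFinite _)
  · rintro e ⟨w, hw⟩
    by_cases ht : t ∈ w.support
    · classical
      exact (not_reach hP hK h' h.symm hne ⟨w.takeUntil t ht, fun hmem =>
        hw (w.support_takeUntil_subset_support ht hmem)⟩).elim
    · exact (Reach.of_adj h.ne.symm hne h').trans ⟨w, ht⟩
  · exact (hsub (Reach.refl h.ne.symm : Reach t t' t')).ne_right rfl

/-- From the time `r` on, until the end of the stage `i`, the human follows the path `w` of triangles
from the triangle `s` that contains the human to the triangle `e` that contains the puppy. -/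
structure IsLeg (c : ℝ) (h p : ℝ → Plane) (τ : ℕ → ℝ) (i : ℕ) (r : ℝ) {s e : Tri K}
    (w : (dualGraph K).Walk s e) : Prop where
  isPath : w.IsPath
  le : τ i ≤ r
  lt : r < τ (i + 1)
  human : h r ∈ s.carrier
  puppy : ∀ ρ ∈ Ico r (τ (i + 1)), p ρ ∈ e.carrier
  walk : ∀ ρ ∈ Icc r (τ (i + 1)), h ρ = walkAlong (h r) (waypoints w) (c * (ρ - r))

theorem IsLeg.mem_region {c : ℝ} {h p : ℝ → Plane} {τ : ℕ → ℝ} {i : ℕ} {r : ℝ} {s t' e : Tri K}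
    {hadj : (dualGraph K).Adj s t'} {w : (dualGraph K).Walk t' e}
    (hleg : IsLeg c h p τ i r (.cons hadj w)) : Reach s t' e ∧ p r ∈ e.carrier := by
  have := (SimpleGraph.Walk.cons_isPath_iff _ _).1 hleg.isPath
  exact ⟨⟨w, this.2⟩, hleg.puppy r ⟨le_rfl, hleg.lt⟩⟩

/-- A double descent: the outer induction bounds the number of triangles beyond the next gate, the
inner one the number of stages that can begin before the human arrives there. -/
theorem isLeg_false (hpoly : IsSimple poly) (hP : IsRegion poly P)
    (hK : IsTriangulation poly P K) {c : ℝ} (hc : 0 < c) {p₀ : Plane} {h p : ℝ → Plane}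
    (hp : IsGreedyPuppy P p₀ h p) (hne : ∀ r, 0 ≤ r → h r ≠ p r) {τ : ℕ → ℝ} (hτ0 : τ 0 = 0)
    (hτ : StrictMono τ) (hτlim : Tendsto τ atTop atTop)
    (hstage : ∀ i, IsStage K c h p (τ i) (τ (i + 1))) :
    ∀ (N i : ℕ) (r : ℝ) (s t' e : Tri K) (hadj : (dualGraph K).Adj s t')
      (w : (dualGraph K).Walk t' e), {f | Reach s t' f}.ncard < N →
      ¬ IsLeg c h p τ i r (.cons hadj w) := by
  have hτnn : ∀ i, 0 ≤ τ i := fun i => hτ0 ▸ hτ.monotone (Nat.zero_le i)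
  have hapart : ∀ {r} {T : Tri K}, 0 ≤ r → h r ∈ T.carrier → p r ∉ T.carrier :=
    fun hr hhT hpT => hne _ hr (eq_of_isStable hK (hp.isStable hr) hpT hhT).symm
  intro N
  induction N with
  | zero => intro i r s t' e hadj w hN; omega
  | succ N ihN =>
  intro i r s t' e hadj w hN hleg
  -- Stage `J` begins only after the expected arrival at the gate; `k` bounds the number of stages
  -- left until then.
  obtain ⟨J, hJ⟩ := (hτlim.eventually (eventually_gt_atTop
    (r + dist (h r) (gate s t') / c))).exists
  obtain ⟨k, hk⟩ : ∃ k, J ≤ i + k := ⟨J, by omega⟩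
  induction k generalizing i r e with
  | zero =>
    have h1 := hτ.monotone hk
    have h2 := hleg.le
    have : 0 ≤ dist (h r) (gate s t') / c := by positivity
    simp only [add_zero] at h1
    linarith
  | succ k ihk =>
  have hr0 : 0 ≤ r := (hτnn i).trans hleg.le
  obtain ⟨hreach, hpr⟩ := hleg.mem_region
  set g := gate s t' with hg
  set D := dist (h r) g with hD
  have hDnn : 0 ≤ D := dist_nonneg
  have hgs : g ∈ s.carrier := gate_mem_left hadj
  have hgt : g ∈ t'.carrier := gate_mem_right hadj
  have hpath := (SimpleGraph.Walk.cons_isPath_iff _ _).1 hleg.isPath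
  have hwalk : ∀ ρ ∈ Icc r (τ (i + 1)), h ρ = walkAlong (h r) (g :: waypoints w) (c * (ρ - r)) :=
    hleg.walk
  rcases lt_or_ge (r + D / c) (τ (i + 1)) with hlt | hge
  · -- the gate is reached within the stage
    have hcD : c * (r + D / c - r) = D := by field_simp; ring
    have hr' : r ≤ r + D / c := by linarith [div_nonneg hDnn hc.le]
    have hhr' : h (r + D / c) = g := by
      rw [hwalk _ ⟨hr', hlt.le⟩, hcD, walkAlong_cons_of_ge _ le_rfl, sub_self, walkAlong_zero]
    cases w with
    | nil =>
      exact hapart (hr0.trans hr') (by rw [hhr']; exact hgt) (hleg.puppy _ ⟨hr', hlt⟩)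
    | @cons _ t'' _ h2 w =>
      have hts : t'' ≠ s := by
        rintro rfl
        exact hpath.2 (by simp)
      refine ihN i (r + D / c) t' t'' e h2 w
        (by have := ncard_reach_lt hP hK hadj h2 hts; omega)
        ⟨hpath.1, hleg.le.trans hr', hlt, by rw [hhr']; exact hgt,
          fun ρ hρ => hleg.puppy ρ ⟨hr'.trans hρ.1, hρ.2⟩, fun ρ hρ => ?_⟩
      have hle : D ≤ c * (ρ - r) := by
        rw [← hcD]
        exact mul_le_mul_of_nonneg_left (by linarith [hρ.1]) hc.le
      rw [hhr', hwalk ρ ⟨hr'.trans hρ.1, hρ.2⟩, walkAlong_cons_of_ge _ hle]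
      congr 1
      rw [← hD]
      field_simp
      ring
  · -- the stage ends before the gate is reached
    set ρ := τ (i + 1) with hρ
    have hL0 : 0 < c * (ρ - r) := mul_pos hc (by linarith [hleg.lt])
    have hLe : ∀ x ∈ Icc r ρ, c * (x - r) ≤ D := by
      intro x hx
      have : x - r ≤ D / c := by linarith [hx.2]
      rwa [le_div_iff₀ hc, mul_comm] at this
    have hLD : c * (ρ - r) ≤ D := hLe ρ ⟨hleg.lt.le, le_rfl⟩
    have hD0 : 0 < D := hL0.trans_le hLD
    have hline : ∀ x ∈ Icc r ρ, h x = AffineMap.lineMap (h r) g (c * (x - r) / D) := fun x hx => by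
      rw [hwalk x hx, walkAlong_cons_of_le _ (hLe x hx)]
    have hins : ∀ x ∈ Icc r ρ, h x ∈ s.carrier := fun x hx => by
      rw [hline x hx]
      exact s.convex_carrier.lineMap_mem hleg.human hgs
        ⟨div_nonneg (mul_nonneg hc.le (by linarith [hx.1])) hDnn,
          (div_le_one hD0).2 (hLe x hx)⟩
    have hρI : ρ ∈ Icc r ρ := ⟨hleg.lt.le, le_rfl⟩
    have hρ0 : 0 ≤ ρ := hτnn _
    have hpρ : p ρ ∈ region s t' := hp.mem_region hpoly hP hK hne hr0 hleg.lt.le hins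
      (Puppy.mem_region.2 ⟨e, hreach, hpr⟩)
    have hps : p ρ ∉ s.carrier := hapart hρ0 (hins ρ hρI)
    obtain ⟨f, hf, hpf⟩ := Puppy.mem_region.1 hpρ
    -- a path that leaves `s` towards the puppy leaves `s` through the same gate
    have hunique : ∀ {y f' : Tri K}, (dualGraph K).Adj s y → Reach s y f' →
        p ρ ∈ f'.carrier → y = t' := by
      intro y f' hy hyf hpf'
      by_contra hyt
      exact not_reach hP hK hadj hy (Ne.symm hyt) (hf.trans
        ((reach_of_mem hpoly hP hK hf.ne_right hyf.ne_right hpf hpf' hps).trans hyf.symm))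
    obtain ⟨s₂, e₂, ⟨w₂, hw₂⟩, hhs, hpe, hw⟩ := hstage (i + 1)
    have hlt' : ρ < τ (i + 1 + 1) := hτ (Nat.lt_succ_self _)
    have hpe₂ : p ρ ∈ e₂.carrier := hpe ρ ⟨le_rfl, hlt'⟩
    cases w₂ with
    | nil => exact hapart hρ0 hhs hpe₂
    | @cons _ x _ hx w₂ =>
    have hleg₂ : IsLeg c h p τ (i + 1) ρ (.cons hx w₂) := ⟨hw₂, le_rfl, hlt', hhs, hpe, hw⟩
    -- Some positive distance towards the gate has been walked, so only `s` and `t'` can contain the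
    -- human. The choice `t'` is possible at the gate or when walking along the common edge.
    have hcases : s₂ = s ∨ s₂ = t' := by
      refine eq_or_eq_of_co_pos hadj (hins ρ hρI) (fun v hv hv' => ?_) hhs
      rw [hline ρ hρI]
      exact co_lineMap_gate_pos hadj hleg.human (div_pos hL0 hD0) ((div_le_one hD0).2 hLD) hv hv'
    rcases hcases with rfl | rfl
    · obtain rfl := hunique hx hleg₂.mem_region.1 hpe₂
      refine ihk (i + 1) ρ e₂ w₂ hleg₂ ?_ (by omega)
      have hdist : dist (h ρ) g = D - c * (ρ - r) := by
        rw [hline ρ hρI, dist_lineMap_right, Real.norm_of_nonneg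
          (by linarith [(div_le_one hD0).2 hLD]), ← hD]
        field_simp
      rw [hdist]
      -- The expected arrival time is unchanged, so the same `J` serves.
      have : ρ + (D - c * (ρ - r)) / c = r + D / c := by field_simp; ring
      rwa [this]
    -- A path going back from `t'` into `s` cannot end there, and by `hunique` it would have to
    -- return to `t'`, which a path visits only once.
    · have hxs : x ≠ s := by
        rintro rfl
        cases w₂ with
        | nil => exact hps hpe₂
        | @cons _ y _ hy w₃ =>
          have h3 := (SimpleGraph.Walk.cons_isPath_iff _ _).1 hw₂
          have h4 := (SimpleGraph.Walk.cons_isPath_iff _ _).1 h3.1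
          have := hunique hy ⟨w₃, h4.2⟩ hpe₂
          subst this
          exact h3.2 (by simp)
      exact ihN (i + 1) ρ s₂ x e₂ hx w₂
        (by have := ncard_reach_lt hP hK hadj hx hxs; omega) hleg₂

end Puppy

theorem mainTheorem9 {n : ℕ} (poly : Polygon Puppy.Plane n) (hpoly : Puppy.IsSimple poly)
    (P : Set Puppy.Plane) (hP : Puppy.IsRegion poly P)
    (K : Geometry.SimplicialComplex ℝ Puppy.Plane) (hK : Puppy.IsTriangulation poly P K)
    (c : ℝ) (hc : 0 < c) (p₀ : Puppy.Plane) (hp₀ : p₀ ∈ P)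
    (h p : ℝ → Puppy.Plane) (hp : Puppy.IsGreedyPuppy P p₀ h p)
    (hh : Puppy.FollowsStrategy K c h p) :
    ∃ t : ℝ, 0 ≤ t ∧ h t = p t := by
  by_contra! hne
  obtain ⟨τ, hτ0, hτ, hτlim, hstage⟩ := hh
  obtain ⟨s, e, ⟨w, hw⟩, hhs, hpe, hwalk⟩ := hstage 0
  have hlt : τ 0 < τ (0 + 1) := hτ (Nat.lt_succ_self _)
  cases w with
  | nil =>
    have h0 : 0 ≤ τ 0 := hτ0.ge
    exact hne _ h0
      (Puppy.eq_of_isStable hK (hp.isStable h0) (hpe _ ⟨le_rfl, hlt⟩) hhs).symm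
  | @cons _ t' _ hadj w =>
    exact Puppy.isLeg_false hpoly hP hK hc hp hne hτ0 hτ hτlim hstage _ 0 (τ 0) s t' e hadj w
      (Nat.lt_succ_self _) ⟨hw, le_rfl, hlt, hhs, hpe, hwalk⟩
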